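/- Let $0<Q<1$ and let $(\xi_x)_{x\ge 1}$, $(u_y)_{y\ge 1}$ be positive reals with $\xi_x u_y>1/\sqrt Q$ for all $x,y\ge 1$. Put $$t=Q,\qquad a_x=\frac{\sqrt t}{\xi_x}\ (x\ge 1),\qquad b_y=\frac{1}{t\,u_y}\ (y\ge 1),$$ so that $a_x,b_y>0$ and $a_xb_y<1$. *Stochastic six vertex model.* On the quadrant with vertices $(x,y)$, $x,y\ge 1$, every horizontal edge $(0,y)\to(1,y)$ is occupied by an entering path and no vertical edge $(x,0)\to(x,1)$ is. Visiting the vertices along the diagonals $x+y=2,3,\dots$, given the edges found so far, the outgoing (right, top) edges of each vertex $(x,y)$ are chosen independently as follows, with $s=\xi_xu_y$. If both or none of the incoming (left, bottom) edges are occupied, then both, respectively none, of the outgoing edges are. If only the left edge is occupied, the path goes right with probability $\frac{1/Q-s/\sqrt Q}{1-s/\sqrt Q}$ and up with probability $\frac{1-1/Q}{1-s/\sqrt Q}$. If only the bottom edge is occupied, the path goes up with probability $\frac{1-\sqrt Q\,s}{1-s/\sqrt Q}$ and right with probability $\frac{(Q-1)s/\sqrt Q}{1-s/\sqrt Q}$.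 The height $h(x,y)$ is the number of paths that pass through or to the right of $(x,y)$, that is, the number of occupied horizontal edges $(x-1,y')\to(x,y')$ with $1\le y'\le y$. *Ascending Hall–Littlewood process.* For positive integers $M,N$, sequences of partitions $\lambda^{(1)}\subset\dots\subset\lambda^{(M)}$ have probability $$\frac{P_{\lambda^{(1)}}(a_1)P_{\lambda^{(2)}/\lambda^{(1)}}(a_2)\cdots P_{\lambda^{(M)}/\lambda^{(M-1)}}(a_M)\,Q_{\lambda^{(M)}}(b_1,\dots,b_N)}{\prod_{j=1}^N\prod_{i=1}^M\frac{1-ta_ib_j}{1-a_ib_j}},$$ where $P,Q$ are the (skew) Hall–Littlewood polynomials with parameter $t$. For $m\le M$ let $\lambda_1'(m,N)$ be the number of nonzero parts of $\lambda^{(m)}$. Then for all positive integers $N,k,M$ and $m_1,\dots,m_k\in\{1,\dots,M\}$, the random vectors $$\bigl(N-\lambda'_1(m_1,N),\dots,N-\lambda'_1(m_k,N)\bigr)\quad\text{and}\quad\bigl(h(m_1+1,N),\dots,h(m_k+1,N)\bigr)$$ have the same joint distribution. -/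

import Mathlib

open MeasureTheory ProbabilityTheory

/-! ### Hall--Littlewood processes

A partition `λ` is a `YoungDiagram`: its parts are `λ_{i+1} = λ.rowLen i` (zero beyond the length),
the column lengths are `λ'_{j+1} = λ.colLen j`, and `|λ| = λ.card`. -/

instance : MeasurableSpace YoungDiagram := ⊤

/-- The multiplicity `m_i(λ) = #{j : λ_j = i}` of the part `i ≥ 1`. -/
def partMult (lam : YoungDiagram) (i : ℕ) : ℕ := lam.rowLens.count i

/-- `μ ≺ λ`: the interlacing `λ_1 ≥ μ_1 ≥ λ_2 ≥ μ_2 ≥ ⋯`. -/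
def Interlaces (mu lam : YoungDiagram) : Prop :=
  ∀ i, mu.rowLen i ≤ lam.rowLen i ∧ lam.rowLen (i + 1) ≤ mu.rowLen i

open Classical in
/-- The one-variable skew Hall--Littlewood polynomial
`P_{λ/μ}(x) = x^{|λ|-|μ|} ∏_{i ≥ 1, m_i(λ)+1 = m_i(μ)} (1 - t^{m_i(μ)})` if `μ ≺ λ`, and `0` otherwise.
Parts `i > λ_1` contribute nothing to the product. -/
noncomputable def hlPOne (t : ℝ) (lam mu : YoungDiagram) (x : ℝ) : ℝ :=
  if Interlaces mu lam then
    x ^ (lam.card - mu.card) *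
      ∏ i ∈ (Finset.Icc 1 (lam.rowLen 0)).filter (fun i => partMult lam i + 1 = partMult mu i),
        (1 - t ^ partMult mu i)
  else 0

open Classical in
/-- The one-variable dual skew Hall--Littlewood polynomial
`Q_{λ/μ}(x) = x^{|λ|-|μ|} ∏_{i ≥ 1, m_i(λ) = m_i(μ)+1} (1 - t^{m_i(λ)})` if `μ ≺ λ`, and `0` otherwise. -/
noncomputable def hlQOne (t : ℝ) (lam mu : YoungDiagram) (x : ℝ) : ℝ :=
  if Interlaces mu lam then
    x ^ (lam.card - mu.card) *
      ∏ i ∈ (Finset.Icc 1 (lam.rowLen 0)).filter (fun i => partMult lam i = partMult mu i + 1),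
        (1 - t ^ partMult lam i)
  else 0

open Classical in
/-- The Hall--Littlewood polynomial `Q_λ(b_1, …, b_n)`, by its branching (tableau) expansion
`Q_λ(b_1, …, b_n) = ∑_{∅ = λ⁰ ≺ λ¹ ≺ ⋯ ≺ λⁿ = λ} ∏_{j=1}^n Q_{λʲ/λʲ⁻¹}(b_j)`.
The sums are finite, because `μ ≺ λ` forces `μ ⊂ λ`. -/
noncomputable def hlQ (t : ℝ) (b : ℕ → ℝ) : ℕ → YoungDiagram → ℝ
  | 0, lam => if lam = ⊥ then 1 else 0
  | n + 1, lam => ∑ᶠ mu : YoungDiagram, hlQ t b n mu * hlQOne t lam mu (b (n + 1))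

/-- The partition `λ^{(m)}` of a sequence `λ^{(1)}, …, λ^{(M)}`; `λ^{(0)} = ∅`. -/
def hlLevel {M : ℕ} (lam : Fin M → YoungDiagram) : ℕ → YoungDiagram
  | 0 => ⊥
  | m + 1 => if h : m < M then lam ⟨m, h⟩ else ⊥

/-- The probability of a sequence under the ascending Hall--Littlewood process,
`P_{λ^{(1)}}(a_1) P_{λ^{(2)}/λ^{(1)}}(a_2) ⋯ P_{λ^{(M)}/λ^{(M-1)}}(a_M) Q_{λ^{(M)}}(b_1, …, b_N)`
divided by `∏_{j ≤ N} ∏_{i ≤ M} (1 - t a_i b_j) / (1 - a_i b_j)`. -/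
noncomputable def hlProb (t : ℝ) (a b : ℕ → ℝ) (M N : ℕ) (lam : Fin M → YoungDiagram) : ℝ :=
  ((∏ i ∈ Finset.Icc 1 M, hlPOne t (hlLevel lam i) (hlLevel lam (i - 1)) (a i)) *
      hlQ t b N (hlLevel lam M)) /
    ∏ j ∈ Finset.Icc 1 N, ∏ i ∈ Finset.Icc 1 M, (1 - t * a i * b j) / (1 - a i * b j)

/-- The law of the ascending Hall--Littlewood process `λ^{(1)} ⊂ ⋯ ⊂ λ^{(M)}` with
parameters `t`, `a_1, …, a_M`, `b_1, …, b_N`. -/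
noncomputable def hlProcess (t : ℝ) (a b : ℕ → ℝ) (M N : ℕ) :
    Measure (Fin M → YoungDiagram) :=
  Measure.sum fun lam => ENNReal.ofReal (hlProb t a b M N lam) • Measure.dirac lam

/-! ### The stochastic six vertex model in the quadrant -/

/-- Admissible parameters: `0 < Q < 1`, `ξ_x > 0`, `u_y > 0`, `ξ_x u_y > 1/√Q` for `x, y ≥ 1`. -/
structure SixVertexParams (Q : ℝ) (xi u : ℕ → ℝ) : Prop where
  Q_pos : 0 < Q
  Q_lt_one : Q < 1
  xi_pos : ∀ x, 1 ≤ x → 0 < xi x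
  u_pos : ∀ y, 1 ≤ y → 0 < u y
  lt_mul : ∀ x y, 1 ≤ x → 1 ≤ y → 1 / √Q < xi x * u y

/-- The weight of a vertex with spectral parameter `s = ξ_x u_y`. The first argument records whether
the incoming edges (left, bottom) are occupied, the second one whether the outgoing edges
(right, top) are. All configurations other than the six displayed ones have weight `0`. -/
noncomputable def vertexWeight (Q s : ℝ) : Bool × Bool → Bool × Bool → ℝ
  | (false, false), (false, false) => 1
  | (true, true), (true, true) => 1
  | (true, false), (true, false) => (1 / Q - 1 / √Q * s) / (1 - 1 / √Q * s)
  | (true, false), (false, true) => (1 - 1 / Q) / (1 - 1 / √Q * s)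
  | (false, true), (false, true) => (1 - √Q * s) / (1 - 1 / √Q * s)
  | (false, true), (true, false) => ((Q - 1) * (1 / √Q) * s) / (1 - 1 / √Q * s)
  | _, _ => 0

theorem vertexWeight_denom_neg {Q s : ℝ} (h0 : 0 < Q) (h1 : Q < 1) (hs : 1 / √Q < s) :
    1 - 1 / √Q * s < 0 := by
  have hr : 0 < √Q := Real.sqrt_pos.2 h0
  have hr1 : √Q < 1 := by rw [Real.sqrt_lt' one_pos]; simpa using h1
  have h2 : 1 < 1 / √Q := by rw [lt_div_iff₀ hr]; simpa using hr1
  nlinarith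

theorem vertexWeight_nonneg {Q s : ℝ} (h0 : 0 < Q) (h1 : Q < 1) (hs : 1 / √Q < s)
    (i o : Bool × Bool) : 0 ≤ vertexWeight Q s i o := by
  have hd := vertexWeight_denom_neg h0 h1 hs
  have hr : 0 < √Q := Real.sqrt_pos.2 h0
  have hs0 : 0 < s := lt_trans (by positivity) hs
  have hsq : √Q * √Q = Q := Real.mul_self_sqrt h0.le
  have e1 : 1 / Q = 1 / √Q * (1 / √Q) := by
    rw [one_div_mul_one_div, hsq]
  have hp : 0 < 1 / √Q := by positivity
  obtain ⟨_ | _, _ | _⟩ := i <;> obtain ⟨_ | _, _ | _⟩ := o <;>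
    simp only [vertexWeight, le_refl, zero_le_one] <;>
    refine div_nonneg_of_nonpos ?_ hd.le
  · have : 1 / √Q * √Q = 1 := by field_simp
    nlinarith
  · have : 0 ≤ (1 / √Q) * s := by positivity
    nlinarith
  · have : 1 < 1 / Q := by rw [lt_div_iff₀ h0]; simpa using h1
    linarith
  · rw [e1]; nlinarith

theorem vertexWeight_sum {Q s : ℝ} (h0 : 0 < Q) (h1 : Q < 1) (hs : 1 / √Q < s)
    (i : Bool × Bool) : ∑ o, vertexWeight Q s i o = 1 := by
  have hd := (vertexWeight_denom_neg h0 h1 hs).ne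
  have hr : 0 < √Q := Real.sqrt_pos.2 h0
  have hsq : √Q * √Q = Q := Real.mul_self_sqrt h0.le
  obtain ⟨_ | _, _ | _⟩ := i <;>
    simp only [Fintype.sum_prod_type, Fintype.sum_bool, vertexWeight, add_zero, zero_add]
  · rw [← add_div, div_eq_one_iff_eq hd]
    have : Q * (1 / √Q) = √Q := by rw [mul_one_div, div_eq_iff hr.ne', hsq]
    linear_combination s * this
  · rw [← add_div, div_eq_one_iff_eq hd]
    ring

/-- The conditional law of the outgoing edges (right, top) of the vertex `(v.1 + 1, v.2 + 1)`, given
its incoming edges (left, bottom). -/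
noncomputable def vertexLaw {Q : ℝ} {xi u : ℕ → ℝ} (h : SixVertexParams Q xi u) (v : ℕ × ℕ)
    (i : Bool × Bool) : PMF (Bool × Bool) :=
  PMF.ofFintype (fun o => ENNReal.ofReal (vertexWeight Q (xi (v.1 + 1) * u (v.2 + 1)) i o)) (by
    have hs := h.lt_mul (v.1 + 1) (v.2 + 1) (by simp) (by simp)
    rw [← ENNReal.ofReal_sum_of_nonneg fun o _ => vertexWeight_nonneg h.Q_pos h.Q_lt_one hs i o,
      vertexWeight_sum h.Q_pos h.Q_lt_one hs, ENNReal.ofReal_one])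

/-- A response rule: to each vertex `(v.1 + 1, v.2 + 1)` and each configuration of its incoming
edges (left, bottom), the chosen configuration of its outgoing edges (right, top). -/
abbrev VertexRule := ℕ × ℕ → Bool × Bool → Bool × Bool

/-- Independent random responses at all vertices, distributed according to the vertex weights. -/
noncomputable def ruleMeasure {Q : ℝ} {xi u : ℕ → ℝ} (h : SixVertexParams Q xi u) :
    Measure VertexRule :=
  Measure.infinitePi fun v => Measure.pi fun i => (vertexLaw h v i).toMeasure

instance {Q : ℝ} {xi u : ℕ → ℝ} (h : SixVertexParams Q xi u) :
    IsProbabilityMeasure (ruleMeasure h) := by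
  unfold ruleMeasure; infer_instance

/-- A collection of edges: `(σ x y).1` says whether the edge from `(x, y)` to `(x + 1, y)` is
occupied, `(σ x y).2` whether the edge from `(x, y)` to `(x, y + 1)` is. -/
abbrev EdgeConfig := ℕ → ℕ → Bool × Bool

/-- The state grown from the boundary of the quadrant: paths enter along all horizontal edges
from `(0, y)` to `(1, y)`, `y ≥ 1`, none enters from below, and at each vertex the outgoing
edges are determined by the incoming ones through the rule `ω`. -/
def grow (ω : VertexRule) : EdgeConfig
  | 0, 0 => (false, false)
  | 0, _ + 1 => (true, false)
  | _ + 1, 0 => (false, false)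
  | x + 1, y + 1 => ω (x, y) ((grow ω x (y + 1)).1, (grow ω (x + 1) y).2)
termination_by x y => x + y

theorem measurable_grow_apply (x y : ℕ) : Measurable fun ω : VertexRule => grow ω x y := by
  induction hn : x + y using Nat.strong_induction_on generalizing x y with
  | _ n ih =>
    rcases x with _ | x <;> rcases y with _ | y
    · simp only [grow]; exact measurable_const
    · simp only [grow]; exact measurable_const
    · simp only [grow]; exact measurable_const
    · have h1 : Measurable fun ω : VertexRule => (grow ω x (y + 1)).1 :=
        (ih _ (by omega) x (y + 1) rfl).fst
      have h2 : Measurable fun ω : VertexRule => (grow ω (x + 1) y).2 :=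
        (ih _ (by omega) (x + 1) y rfl).snd
      have h3 : Measurable fun p : (Bool × Bool → Bool × Bool) × (Bool × Bool) => p.1 p.2 :=
        measurable_from_prod_countable_left fun i => measurable_pi_apply i
      simp only [grow]
      exact h3.comp ((measurable_pi_apply (x, y)).prodMk (h1.prodMk h2))

theorem measurable_grow : Measurable grow :=
  measurable_pi_lambda _ fun x => measurable_pi_lambda _ fun y => measurable_grow_apply x y

/-- The stochastic six vertex model in the quadrant, as a probability measure on states: the
vertices are visited along the successive diagonals `x + y = const`, and, given the edges found so
far, the outgoing edges of each vertex are drawn independently with the vertex weights. -/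
noncomputable def sixVertexMeasure {Q : ℝ} {xi u : ℕ → ℝ} (h : SixVertexParams Q xi u) :
    Measure EdgeConfig :=
  (ruleMeasure h).map grow

instance {Q : ℝ} {xi u : ℕ → ℝ} (h : SixVertexParams Q xi u) :
    IsProbabilityMeasure (sixVertexMeasure h) :=
  Measure.isProbabilityMeasure_map measurable_grow.aemeasurable

/-- The boundary conditions of the quadrant. -/
def EdgeConfig.IsBoundary (σ : EdgeConfig) : Prop :=
  σ 0 0 = (false, false) ∧ (∀ y, σ 0 (y + 1) = (true, false)) ∧ ∀ x, σ (x + 1) 0 = (false, false)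

/-- The measure is the one of the Markovian procedure: the restriction to the vertices with
`x + y < n + 2` equals a prescribed one with probability the product of the vertex weights. -/
theorem sixVertexMeasure_cylinder {Q : ℝ} {xi u : ℕ → ℝ} (h : SixVertexParams Q xi u)
    (τ : EdgeConfig) (hτ : τ.IsBoundary) (n : ℕ) :
    sixVertexMeasure h {σ | ∀ x y, x + y < n → σ (x + 1) (y + 1) = τ (x + 1) (y + 1)} =
      ∏ v ∈ (Finset.range n ×ˢ Finset.range n).filter (fun v => v.1 + v.2 < n),
        ENNReal.ofReal (vertexWeight Q (xi (v.1 + 1) * u (v.2 + 1))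
          ((τ v.1 (v.2 + 1)).1, (τ (v.1 + 1) v.2).2) (τ (v.1 + 1) (v.2 + 1))) := by
  set F := (Finset.range n ×ˢ Finset.range n).filter (fun v => v.1 + v.2 < n) with hF
  have hm : MeasurableSet {σ : EdgeConfig |
      ∀ x y, x + y < n → σ (x + 1) (y + 1) = τ (x + 1) (y + 1)} := by
    simp only [Set.ofPred_forall]
    refine MeasurableSet.iInter fun x => MeasurableSet.iInter fun y =>
      MeasurableSet.iInter fun _ => ?_
    have hxy : Measurable fun σ : EdgeConfig => σ (x + 1) (y + 1) := by fun_prop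
    exact hxy (measurableSet_singleton (τ (x + 1) (y + 1)))
  rw [sixVertexMeasure, Measure.map_apply measurable_grow hm]
  have hset : grow ⁻¹' {σ : EdgeConfig |
      ∀ x y, x + y < n → σ (x + 1) (y + 1) = τ (x + 1) (y + 1)} =
      Set.pi (F : Set (ℕ × ℕ)) fun v => {f : Bool × Bool → Bool × Bool |
        f ((τ v.1 (v.2 + 1)).1, (τ (v.1 + 1) v.2).2) = τ (v.1 + 1) (v.2 + 1)} := by
    ext ω
    simp only [Set.mem_preimage, Set.mem_ofPred_eq, Set.mem_pi]
    have hedge : ∀ (x y : ℕ), (∀ x' y', x' + y' < x + y →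
        grow ω (x' + 1) (y' + 1) = τ (x' + 1) (y' + 1)) →
        grow ω (x + 1) (y + 1) = ω (x, y) ((τ x (y + 1)).1, (τ (x + 1) y).2) := by
      intro x y hxy
      have e1 : grow ω x (y + 1) = τ x (y + 1) := by
        rcases x with _ | x
        · rw [hτ.2.1]; simp only [grow]
        · exact hxy x y (by omega)
      have e2 : grow ω (x + 1) y = τ (x + 1) y := by
        rcases y with _ | y
        · rw [hτ.2.2]; simp only [grow]
        · exact hxy x y (by omega)
      rw [grow, e1, e2]
    constructor
    · rintro hω ⟨x, y⟩ hv
      simp only [hF, Finset.coe_filter, Finset.mem_product, Finset.mem_range,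
        Set.mem_ofPred_eq] at hv
      rw [← hω x y hv.2]
      exact (hedge x y fun x' y' h' => hω x' y' (by omega)).symm
    · intro hω x y
      induction hk : x + y using Nat.strong_induction_on generalizing x y with
      | _ k ih =>
        intro hlt
        rw [hedge x y fun x' y' h' => ih (x' + y') (by omega) x' y' rfl (by omega)]
        exact hω (x, y) (by
          simp only [hF, Finset.coe_filter, Finset.mem_product, Finset.mem_range, Set.mem_ofPred_eq]
          omega)
  rw [hset, ruleMeasure, Measure.infinitePi_pi]
  swap
  · intro v _
    have hv : Measurable fun f : Bool × Bool → Bool × Bool =>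
        f ((τ v.1 (v.2 + 1)).1, (τ (v.1 + 1) v.2).2) := measurable_pi_apply _
    exact hv (measurableSet_singleton (τ (v.1 + 1) (v.2 + 1)))
  refine Finset.prod_congr rfl fun v _ => ?_
  have := (measurePreserving_eval (fun i => (vertexLaw h v i).toMeasure)
    ((τ v.1 (v.2 + 1)).1, (τ (v.1 + 1) v.2).2)).measure_preimage
      (measurableSet_singleton (τ (v.1 + 1) (v.2 + 1))).nullMeasurableSet
  refine this.trans ?_
  rw [PMF.toMeasure_apply_singleton _ _ (measurableSet_singleton _)]
  rfl

/-- The height function `h(x, y)`, `x, y ≥ 1`: the number of up-right paths which go through or to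
the right of `(x, y)`. These are the paths that enter the column `x` at a height `≤ y`, and each of
them does so along exactly one horizontal edge from `(x - 1, y')` to `(x, y')` with `1 ≤ y' ≤ y`. -/
def heightFn (σ : EdgeConfig) (x y : ℕ) : ℕ :=
  ((Finset.Icc 1 y).filter fun y' => (σ (x - 1) y').1 = true).card

/-- The matching `t = Q`, `a_x = √t / ξ_x`, `b_y = 1 / (t u_y)` for all `x, y ≥ 1`. -/
structure ParamsMatch (t : ℝ) (a b : ℕ → ℝ) (Q : ℝ) (xi u : ℕ → ℝ) : Prop where
  t_eq : t = Q
  a_eq : ∀ x, 1 ≤ x → a x = √t / xi x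
  b_eq : ∀ y, 1 ≤ y → b y = 1 / (t * u y)

/-! Write `ℓ` for the number of parts. Around a vertex `(x, n)` place four partitions: `κ` at the
lower left corner, `μ` at the lower right, `λ` at the upper left, `ν` at the upper right. Steps to
the right carry the weights `P_{μ/κ}(a)` and `P_{ν/λ}(a)`, steps upwards carry `Q_{λ/κ}(b)` and
`Q_{ν/μ}(b)`, where `a = a_x`, `b = b_n`. Let a vertical edge be occupied when the step to the right
that it cuts adds a part, and a horizontal edge when the upward step that it cuts adds none.

The heart is a skew Cauchy identity refined by these edges (`exists_hasSum_vertexWeight`). For fixed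
`λ`, `μ` and prescribed outgoing edges, the sum of `P_{ν/λ}(a) Q_{ν/μ}(b)` over the matching `ν`
equals `(1 - tab)/(1 - ab)` times the sum over `κ` of `P_{μ/κ}(a) Q_{λ/κ}(b)`, weighted by the six
vertex probability of these outgoing edges given the incoming ones read off `κ`. Summation over the
outgoing edges gives back the usual skew Cauchy identity. The refinement holds because the
one-variable functions split into a factor depending on the first two columns and the same function
of the diagrams without their first column. Removing first columns one after the other reduces the
identity to `λ = μ = ∅`, a geometric series. The induction carries the sums for each value of `ℓ(ν)`
and `ℓ(κ)` (`RefinedCauchy.step`, `exists_refinedCauchy`).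

Applied column by column, the local identity moves a factor `Q(b)` through a whole chain `∅ ≺ λ¹ ≺ ⋯
≺ λᴹ` and produces one row of the six vertex model (`tsum_chainWeight_mul_hlQOne`). Hence the
unnormalized law of the increments of `ℓ` along the chain satisfies in `N` the recursion of the rows
of vertical edges, up to the Cauchy factors (`tsum_chainWeight_mul_hlQ_succ`,
`ruleMeasure_bitList_succ`). Both start from the empty row at `N = 0`, and the factors build up the
normalizing product. So the increments of `ℓ` and the vertical edges above row `N` have the same
law.

Finally, `ℓ(λᵐ)` counts the occupied vertical edges in the columns up to `m`. Conservation of paths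
turns the same count into `N - h(m + 1, N)` (`heightFn_grow_add`). The vectors of the theorem are
therefore, almost surely, the same function of two identically distributed rows of bits. -/

open scoped ENNReal

/-! ### Young diagrams and removal of the first column -/

namespace YoungDiagram

theorem colLen_eq_of_forall {lam : YoungDiagram} {j n : ℕ} (h : ∀ i, (i, j) ∈ lam ↔ i < n) :
    lam.colLen j = n :=
  eq_of_forall_lt_iff fun i => by rw [← mem_iff_lt_colLen, h]

theorem rowLen_eq_of_forall {lam : YoungDiagram} {i n : ℕ} (h : ∀ j, (i, j) ∈ lam ↔ j < n) :
    lam.rowLen i = n :=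
  eq_of_forall_lt_iff fun j => by rw [← mem_iff_lt_rowLen, h]

@[simp]
theorem colLen_bot (j : ℕ) : (⊥ : YoungDiagram).colLen j = 0 :=
  colLen_eq_of_forall fun i => by simp

theorem eq_bot_of_colLen {lam : YoungDiagram} (h : lam.colLen 0 = 0) : lam = ⊥ := by
  apply SetLike.ext
  rintro ⟨i, j⟩
  simp only [notMem_bot, iff_false]
  intro hij
  have := lam.up_left_mem le_rfl (Nat.zero_le j) hij
  rw [mem_iff_lt_colLen] at this
  omega

theorem eq_bot_of_rowLen {lam : YoungDiagram} (h : lam.rowLen 0 = 0) : lam = ⊥ := by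
  apply eq_bot_of_colLen
  by_contra h0
  have : (0, 0) ∈ lam := mem_iff_lt_colLen.2 (by omega)
  rw [mem_iff_lt_rowLen] at this
  omega

/-- The Young diagram with its first column removed. -/
def dropCol (lam : YoungDiagram) : YoungDiagram where
  cells := (lam.cells.filter fun p => p.2 ≠ 0).image fun p => (p.1, p.2 - 1)
  isLowerSet := by
    rintro ⟨i, j⟩ ⟨i', j'⟩ ⟨hi : i' ≤ i, hj : j' ≤ j⟩ h
    simp only [Finset.mem_coe, Finset.mem_image, Finset.mem_filter, mem_cells, Prod.exists,
      Prod.mk.injEq] at h ⊢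
    obtain ⟨p, q, ⟨h1, h2⟩, rfl, rfl⟩ := h
    exact ⟨i', j' + 1, ⟨lam.up_left_mem hi (by omega) h1, by omega⟩, rfl, rfl⟩

@[simp]
theorem mem_dropCol {lam : YoungDiagram} {i j : ℕ} : (i, j) ∈ lam.dropCol ↔ (i, j + 1) ∈ lam := by
  rw [← mem_cells]
  simp only [dropCol, Finset.mem_image, Finset.mem_filter, mem_cells, Prod.exists, Prod.mk.injEq]
  constructor
  · rintro ⟨p, q, ⟨h1, h2⟩, rfl, rfl⟩
    rwa [Nat.sub_add_cancel (Nat.one_le_iff_ne_zero.2 h2)]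
  · intro h
    exact ⟨i, j + 1, ⟨h, by omega⟩, rfl, rfl⟩

@[simp]
theorem colLen_dropCol (lam : YoungDiagram) (j : ℕ) : lam.dropCol.colLen j = lam.colLen (j + 1) :=
  colLen_eq_of_forall fun i => by rw [mem_dropCol, mem_iff_lt_colLen]

@[simp]
theorem rowLen_dropCol (lam : YoungDiagram) (i : ℕ) : lam.dropCol.rowLen i = lam.rowLen i - 1 :=
  rowLen_eq_of_forall fun j => by rw [mem_dropCol, mem_iff_lt_rowLen]; omega

@[simp]
theorem dropCol_bot : (⊥ : YoungDiagram).dropCol = ⊥ := eq_bot_of_colLen (by simp)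

theorem card_eq_colLen_add_card_dropCol (lam : YoungDiagram) :
    lam.card = lam.colLen 0 + lam.dropCol.card := by
  have h := Finset.card_filter_add_card_filter_not (s := lam.cells) (fun c => c.2 = 0)
  rw [colLen_eq_card, col, YoungDiagram.card, ← h, YoungDiagram.card]
  congr 1
  symm
  refine Finset.card_bij (fun p _ => (p.1, p.2 + 1)) ?_ ?_ ?_
  · rintro ⟨i, j⟩ hp
    simpa using hp
  · rintro ⟨i, j⟩ _ ⟨i', j'⟩ _ h'
    simpa using h'
  · rintro ⟨i, _ | j⟩ hp
    · simp at hp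
    · exact ⟨(i, j), by simpa using hp, rfl⟩

/-- Put a column of length `r` to the left of a Young diagram, cutting the diagram off below
the row `r`. -/
def consCol (r : ℕ) (lam : YoungDiagram) : YoungDiagram where
  cells := (Finset.range r ×ˢ Finset.range (lam.rowLen 0 + 1)).filter
    fun p => p.2 = 0 ∨ (p.1, p.2 - 1) ∈ lam
  isLowerSet := by
    rintro ⟨i, j⟩ ⟨i', j'⟩ ⟨hi : i' ≤ i, hj : j' ≤ j⟩ h
    simp only [Finset.coe_filter, Finset.mem_product, Finset.mem_range, Set.mem_ofPred_eq] at h ⊢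
    refine ⟨⟨by omega, by omega⟩, ?_⟩
    rcases h.2 with h0 | h0
    · left; omega
    · right; exact lam.up_left_mem hi (by omega) h0

theorem mem_consCol {r : ℕ} {lam : YoungDiagram} {i j : ℕ} :
    (i, j) ∈ consCol r lam ↔ i < r ∧ (j = 0 ∨ (i, j - 1) ∈ lam) := by
  rw [← mem_cells]
  simp only [consCol, Finset.mem_filter, Finset.mem_product, Finset.mem_range]
  constructor
  · rintro ⟨⟨h1, -⟩, h2⟩; exact ⟨h1, h2⟩
  · rintro ⟨h1, h2⟩
    refine ⟨⟨h1, ?_⟩, h2⟩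
    rcases h2 with h2 | h2
    · omega
    · have := lam.up_left_mem (Nat.zero_le i) le_rfl h2
      rw [mem_iff_lt_rowLen] at this
      omega

@[simp]
theorem colLen_consCol (r : ℕ) (lam : YoungDiagram) : (consCol r lam).colLen 0 = r :=
  colLen_eq_of_forall fun i => by simp [mem_consCol]

theorem dropCol_consCol {r : ℕ} {lam : YoungDiagram} (h : lam.colLen 0 ≤ r) :
    (consCol r lam).dropCol = lam := by
  apply SetLike.ext
  rintro ⟨i, j⟩
  rw [mem_dropCol, mem_consCol]
  simp only [Nat.add_eq_zero_iff, one_ne_zero, and_false, Nat.add_sub_cancel, false_or,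
    and_iff_right_iff_imp]
  intro hij
  have := lam.up_left_mem le_rfl (Nat.zero_le j) hij
  rw [mem_iff_lt_colLen] at this
  omega

theorem consCol_dropCol (lam : YoungDiagram) : consCol (lam.colLen 0) lam.dropCol = lam := by
  apply SetLike.ext
  rintro ⟨i, _ | j⟩
  · rw [mem_consCol, mem_iff_lt_colLen (μ := lam)]; simp
  · rw [mem_consCol]
    simp only [Nat.add_eq_zero_iff, one_ne_zero, and_false, Nat.add_sub_cancel, false_or,
      mem_dropCol, and_iff_right_iff_imp]
    intro hij
    have := lam.up_left_mem le_rfl (Nat.zero_le _) hij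
    rwa [mem_iff_lt_colLen] at this

/-- Removing the first column identifies the diagrams with first column `r` with those with first
column at most `r`. -/
def dropColEquiv (r : ℕ) :
    {lam : YoungDiagram // lam.colLen 0 = r} ≃ {lam : YoungDiagram // lam.colLen 0 ≤ r} where
  toFun lam := ⟨lam.1.dropCol, by
    rw [colLen_dropCol]; exact (lam.1.colLen_anti _ _ (by omega)).trans lam.2.le⟩
  invFun lam := ⟨consCol r lam.1, colLen_consCol r lam.1⟩
  left_inv := by rintro ⟨lam, rfl⟩; exact Subtype.ext (consCol_dropCol lam)
  right_inv := by rintro ⟨lam, h⟩; exact Subtype.ext (dropCol_consCol h)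

theorem finite_le (lam : YoungDiagram) : {mu : YoungDiagram | mu ≤ lam}.Finite := by
  refine Set.Finite.of_finite_image (f := YoungDiagram.cells)
    ((lam.cells.powerset.finite_toSet).subset ?_) ?_
  · rintro _ ⟨mu, hmu, rfl⟩
    simpa using hmu
  · intro mu _ nu _ h
    exact YoungDiagram.ext h

instance : Countable YoungDiagram :=
  Function.Injective.countable (f := YoungDiagram.cells) fun _ _ h => YoungDiagram.ext h

end YoungDiagram

/-! ### Interlacing by columns and the first-column factorization -/

open YoungDiagram


/-- The skew diagram is a horizontal strip: no column contains two of its cells. In this form the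
columns decouple, which makes removal of the first column possible. -/
theorem interlaces_iff_colLen {mu lam : YoungDiagram} :
    Interlaces mu lam ↔ ∀ j, mu.colLen j ≤ lam.colLen j ∧ lam.colLen j ≤ mu.colLen j + 1 := by
  constructor
  · intro h j
    constructor
    · by_contra hlt
      have h1 : (lam.colLen j, j) ∈ mu := mem_iff_lt_colLen.2 (by omega)
      have h2 : (lam.colLen j, j) ∈ lam :=
        mem_iff_lt_rowLen.2 (lt_of_lt_of_le (mem_iff_lt_rowLen.1 h1) (h _).1)
      exact lt_irrefl _ (mem_iff_lt_colLen.1 h2)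
    · by_contra hlt
      have h1 : (mu.colLen j + 1, j) ∈ lam := mem_iff_lt_colLen.2 (by omega)
      have h2 : (mu.colLen j, j) ∈ mu :=
        mem_iff_lt_rowLen.2 (lt_of_lt_of_le (mem_iff_lt_rowLen.1 h1) (h _).2)
      exact lt_irrefl _ (mem_iff_lt_colLen.1 h2)
  · intro h i
    constructor
    · by_contra hlt
      have h1 : (i, lam.rowLen i) ∈ mu := mem_iff_lt_rowLen.2 (by omega)
      have h2 : (i, lam.rowLen i) ∈ lam :=
        mem_iff_lt_colLen.2 (lt_of_lt_of_le (mem_iff_lt_colLen.1 h1) (h _).1)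
      exact lt_irrefl _ (mem_iff_lt_rowLen.1 h2)
    · by_contra hlt
      have h1 : (i + 1, mu.rowLen i) ∈ lam := mem_iff_lt_rowLen.2 (by omega)
      have h2 : (i, mu.rowLen i) ∈ mu := by
        have := mem_iff_lt_colLen.1 h1
        have := (h (mu.rowLen i)).2
        exact mem_iff_lt_colLen.2 (by omega)
      exact lt_irrefl _ (mem_iff_lt_rowLen.1 h2)

theorem Interlaces.le {mu lam : YoungDiagram} (h : Interlaces mu lam) : mu ≤ lam := by
  rintro ⟨i, j⟩ hij
  exact mem_iff_lt_rowLen.2 (lt_of_lt_of_le (mem_iff_lt_rowLen.1 hij) (h i).1)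

theorem interlaces_iff_dropCol {mu lam : YoungDiagram} :
    Interlaces mu lam ↔ (mu.colLen 0 ≤ lam.colLen 0 ∧ lam.colLen 0 ≤ mu.colLen 0 + 1) ∧
      Interlaces mu.dropCol lam.dropCol := by
  simp only [interlaces_iff_colLen, colLen_dropCol]
  constructor
  · intro h; exact ⟨h 0, fun j => h (j + 1)⟩
  · rintro ⟨h0, h⟩ (_ | j)
    · exact h0
    · exact h j

theorem interlaces_self (mu : YoungDiagram) : Interlaces mu mu :=
  interlaces_iff_colLen.2 fun j => ⟨le_rfl, by omega⟩

theorem partMult_succ (lam : YoungDiagram) (j : ℕ) :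
    partMult lam (j + 1) = lam.colLen j - lam.colLen (j + 1) := by
  rw [partMult, rowLens, List.count, List.countP_map, List.countP_eq_length_filter]
  have h1 : ((List.range (lam.colLen 0)).filter ((· == j + 1) ∘ lam.rowLen)).length =
      ((Finset.range (lam.colLen 0)).filter (fun i => lam.rowLen i = j + 1)).card := by
    rw [← List.toFinset_card_of_nodup (List.nodup_range.filter _)]
    congr 1
    ext i
    simp
  have h2 : (Finset.range (lam.colLen 0)).filter (fun i => lam.rowLen i = j + 1) =
      Finset.Ico (lam.colLen (j + 1)) (lam.colLen j) := by
    ext i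
    have a1 : i < lam.colLen 0 ↔ 0 < lam.rowLen i := by
      rw [← mem_iff_lt_colLen, mem_iff_lt_rowLen]
    have a2 : i < lam.colLen j ↔ j < lam.rowLen i := by
      rw [← mem_iff_lt_colLen, mem_iff_lt_rowLen]
    have a3 : i < lam.colLen (j + 1) ↔ j + 1 < lam.rowLen i := by
      rw [← mem_iff_lt_colLen, mem_iff_lt_rowLen]
    simp only [Finset.mem_filter, Finset.mem_range, Finset.mem_Ico]
    omega
  rw [h1, h2, Nat.card_Ico]

theorem partMult_dropCol (lam : YoungDiagram) {i : ℕ} (hi : 1 ≤ i) :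
    partMult lam.dropCol i = partMult lam (i + 1) := by
  obtain ⟨j, rfl⟩ : ∃ j, i = j + 1 := ⟨i - 1, by omega⟩
  simp [partMult_succ]

theorem prod_Icc_one_succ {R : Type*} [CommMonoid R] (g : ℕ → R) (n : ℕ) :
    ∏ i ∈ Finset.Icc 1 (n + 1), g i = g 1 * ∏ i ∈ Finset.Icc 1 n, g (i + 1) := by
  induction n with
  | zero => simp
  | succ n ih => rw [Finset.prod_Icc_succ_top (by omega), ih,
      Finset.prod_Icc_succ_top (by omega : 1 ≤ n + 1), mul_assoc]

theorem card_sub_card_eq {mu lam : YoungDiagram} (h : Interlaces mu lam) :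
    lam.card - mu.card =
      (lam.colLen 0 - mu.colLen 0) + (lam.dropCol.card - mu.dropCol.card) := by
  have h1 := Finset.card_le_card h.le
  have h2 := Finset.card_le_card (interlaces_iff_dropCol.1 h).2.le
  have h3 := (interlaces_iff_dropCol.1 h).1
  have h4 : mu.dropCol.card ≤ lam.dropCol.card := h2
  rw [card_eq_colLen_add_card_dropCol lam, card_eq_colLen_add_card_dropCol mu]
  omega

-- The multiplicity of the part `1` is the difference of the first two columns, and each larger
-- multiplicity is one of the diagrams with the first column removed. So only the factor `i = 1` of
-- the product and part of the power of `x` involve the first column.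
open Classical in
theorem hlPOne_eq_dropCol (t : ℝ) (lam mu : YoungDiagram) (x : ℝ) :
    hlPOne t lam mu x =
      if mu.colLen 0 ≤ lam.colLen 0 ∧ lam.colLen 0 ≤ mu.colLen 0 + 1 then
        x ^ (lam.colLen 0 - mu.colLen 0) *
          (if lam.colLen 0 - lam.colLen 1 + 1 = mu.colLen 0 - mu.colLen 1 then
            1 - t ^ (mu.colLen 0 - mu.colLen 1) else 1) * hlPOne t lam.dropCol mu.dropCol x
      else 0 := by
  by_cases h : Interlaces mu lam
  · have h' := interlaces_iff_dropCol.1 h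
    rw [if_pos h'.1]
    unfold hlPOne
    rw [if_pos h, if_pos h'.2, card_sub_card_eq h, pow_add]
    simp only [Finset.prod_filter, rowLen_dropCol]
    -- The product runs over `i ≤ λ_1`, so it has no factor `i = 1` when `λ = ∅`. Then `μ = ∅` too,
    -- and the first-column factor is `1`.
    rcases hn : lam.rowLen 0 with _ | n
    · obtain rfl := eq_bot_of_rowLen hn
      obtain rfl : mu = ⊥ := eq_bot_of_colLen (by simpa using h'.1.1)
      simp
    · rw [prod_Icc_one_succ, partMult_succ, partMult_succ, Nat.add_sub_cancel]
      have : ∀ i ∈ Finset.Icc 1 n, (if partMult lam (i + 1) + 1 = partMult mu (i + 1) then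
          1 - t ^ partMult mu (i + 1) else 1) =
          if partMult lam.dropCol i + 1 = partMult mu.dropCol i then
            1 - t ^ partMult mu.dropCol i else 1 := by
        intro i hi
        rw [partMult_dropCol _ (Finset.mem_Icc.1 hi).1, partMult_dropCol _ (Finset.mem_Icc.1 hi).1]
      rw [Finset.prod_congr rfl this]
      ring
  · rw [hlPOne, if_neg h]
    rw [interlaces_iff_dropCol, not_and] at h
    split_ifs with h1 h2
    · rw [hlPOne, if_neg (h h1), mul_zero]
    · rw [hlPOne, if_neg (h h1), mul_zero]
    · rfl

open Classical in
theorem hlQOne_eq_dropCol (t : ℝ) (lam mu : YoungDiagram) (x : ℝ) :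
    hlQOne t lam mu x =
      if mu.colLen 0 ≤ lam.colLen 0 ∧ lam.colLen 0 ≤ mu.colLen 0 + 1 then
        x ^ (lam.colLen 0 - mu.colLen 0) *
          (if lam.colLen 0 - lam.colLen 1 = mu.colLen 0 - mu.colLen 1 + 1 then
            1 - t ^ (lam.colLen 0 - lam.colLen 1) else 1) * hlQOne t lam.dropCol mu.dropCol x
      else 0 := by
  by_cases h : Interlaces mu lam
  · have h' := interlaces_iff_dropCol.1 h
    rw [if_pos h'.1]
    unfold hlQOne
    rw [if_pos h, if_pos h'.2, card_sub_card_eq h, pow_add]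
    simp only [Finset.prod_filter, rowLen_dropCol]
    rcases hn : lam.rowLen 0 with _ | n
    · obtain rfl := eq_bot_of_rowLen hn
      obtain rfl : mu = ⊥ := eq_bot_of_colLen (by simpa using h'.1.1)
      simp
    · rw [prod_Icc_one_succ, partMult_succ, partMult_succ, Nat.add_sub_cancel]
      have : ∀ i ∈ Finset.Icc 1 n, (if partMult lam (i + 1) = partMult mu (i + 1) + 1 then
          1 - t ^ partMult lam (i + 1) else 1) =
          if partMult lam.dropCol i = partMult mu.dropCol i + 1 then
            1 - t ^ partMult lam.dropCol i else 1 := by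
        intro i hi
        rw [partMult_dropCol _ (Finset.mem_Icc.1 hi).1, partMult_dropCol _ (Finset.mem_Icc.1 hi).1]
      rw [Finset.prod_congr rfl this]
      ring
  · rw [hlQOne, if_neg h]
    rw [interlaces_iff_dropCol, not_and] at h
    split_ifs with h1 h2
    · rw [hlQOne, if_neg (h h1), mul_zero]
    · rw [hlQOne, if_neg (h h1), mul_zero]
    · rfl

theorem interlaces_of_hlPOne_ne_zero {t : ℝ} {lam mu : YoungDiagram} {x : ℝ}
    (h : hlPOne t lam mu x ≠ 0) : Interlaces mu lam := by
  by_contra h'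
  exact h (if_neg h')

theorem interlaces_of_hlQOne_ne_zero {t : ℝ} {lam mu : YoungDiagram} {x : ℝ}
    (h : hlQOne t lam mu x ≠ 0) : Interlaces mu lam := by
  by_contra h'
  exact h (if_neg h')

theorem hlPOne_nonneg {t : ℝ} (h0 : 0 ≤ t) (h1 : t ≤ 1) (lam mu : YoungDiagram) {x : ℝ}
    (hx : 0 ≤ x) : 0 ≤ hlPOne t lam mu x := by
  unfold hlPOne
  split_ifs
  · exact mul_nonneg (pow_nonneg hx _)
      (Finset.prod_nonneg fun i _ => sub_nonneg.2 (pow_le_one₀ h0 h1))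
  · rfl

theorem hlQOne_nonneg {t : ℝ} (h0 : 0 ≤ t) (h1 : t ≤ 1) (lam mu : YoungDiagram) {x : ℝ}
    (hx : 0 ≤ x) : 0 ≤ hlQOne t lam mu x := by
  unfold hlQOne
  split_ifs
  · exact mul_nonneg (pow_nonneg hx _)
      (Finset.prod_nonneg fun i _ => sub_nonneg.2 (pow_le_one₀ h0 h1))
  · rfl

theorem hlPOne_self_bot (t x : ℝ) : hlPOne t ⊥ ⊥ x = 1 := by
  simp [hlPOne, interlaces_self]

theorem hlQOne_self_bot (t x : ℝ) : hlQOne t ⊥ ⊥ x = 1 := by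
  simp [hlQOne, interlaces_self]

theorem hlPOne_colLen_of_ne_zero {t : ℝ} {lam mu : YoungDiagram} {x : ℝ}
    (h : hlPOne t lam mu x ≠ 0) :
    mu.colLen 0 ≤ lam.colLen 0 ∧ lam.colLen 0 ≤ mu.colLen 0 + 1 :=
  interlaces_iff_colLen.1 (interlaces_of_hlPOne_ne_zero h) 0

theorem hlQOne_colLen_of_ne_zero {t : ℝ} {lam mu : YoungDiagram} {x : ℝ}
    (h : hlQOne t lam mu x ≠ 0) :
    mu.colLen 0 ≤ lam.colLen 0 ∧ lam.colLen 0 ≤ mu.colLen 0 + 1 :=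
  interlaces_iff_colLen.1 (interlaces_of_hlQOne_ne_zero h) 0

/-! ### Cauchy sums with a prescribed number of parts, and the base case -/

open Classical in
/-- The summand `P_{ν/λ}(a) Q_{ν/μ}(b)` of the skew Cauchy sum, restricted to `ν` with `r` parts. -/
noncomputable def cauchyUp (t a b : ℝ) (lam mu : YoungDiagram) (r : ℕ) (nu : YoungDiagram) : ℝ :=
  if nu.colLen 0 = r then hlPOne t nu lam a * hlQOne t nu mu b else 0

open Classical in
/-- The summand `P_{μ/κ}(a) Q_{λ/κ}(b)` of the dual skew Cauchy sum, restricted to `κ` with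
`r - 1` parts. -/
noncomputable def cauchyDown (t a b : ℝ) (lam mu : YoungDiagram) (r : ℕ) (ka : YoungDiagram) : ℝ :=
  if ka.colLen 0 + 1 = r then hlPOne t mu ka a * hlQOne t lam ka b else 0

/-- The one-row diagram with `n` cells. -/
def oneRow : ℕ → YoungDiagram
  | 0 => ⊥
  | n + 1 => consCol 1 (oneRow n)

theorem colLen_oneRow_le (n : ℕ) : (oneRow n).colLen 0 ≤ 1 := by
  cases n <;> simp [oneRow]

@[simp]
theorem dropCol_oneRow_succ (n : ℕ) : (oneRow (n + 1)).dropCol = oneRow n :=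
  dropCol_consCol (colLen_oneRow_le n)

@[simp]
theorem colLen_oneRow_succ (n : ℕ) : (oneRow (n + 1)).colLen 0 = 1 := colLen_consCol _ _

theorem oneRow_injective : Function.Injective oneRow := by
  intro m
  induction m with
  | zero =>
    rintro (_ | n) h
    · rfl
    · have := congrArg (fun lam => YoungDiagram.colLen lam 0) h
      simp [oneRow] at this
  | succ m ih =>
    rintro (_ | n) h
    · have := congrArg (fun lam => YoungDiagram.colLen lam 0) h
      simp [oneRow] at this
    · have := congrArg YoungDiagram.dropCol h
      simp only [dropCol_oneRow_succ] at this
      rw [ih this]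

theorem exists_eq_oneRow {nu : YoungDiagram} (h : nu.colLen 0 ≤ 1) : ∃ n, nu = oneRow n := by
  induction hn : nu.card using Nat.strong_induction_on generalizing nu with
  | _ n ih =>
    rcases Nat.le_one_iff_eq_zero_or_eq_one.1 h with h0 | h1
    · exact ⟨0, eq_bot_of_colLen h0⟩
    · have hc := card_eq_colLen_add_card_dropCol nu
      obtain ⟨k, hk⟩ := ih nu.dropCol.card (by omega) (nu := nu.dropCol)
        (by rw [colLen_dropCol]; exact (nu.colLen_anti _ _ (by omega)).trans h) rfl
      refine ⟨k + 1, ?_⟩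
      rw [oneRow, ← hk, ← h1, consCol_dropCol]

theorem hlPOne_oneRow (t a : ℝ) (n : ℕ) : hlPOne t (oneRow n) ⊥ a = a ^ n := by
  induction n with
  | zero => simp [oneRow, hlPOne_self_bot]
  | succ n ih =>
    rw [hlPOne_eq_dropCol, dropCol_oneRow_succ, dropCol_bot, ih]
    simp [pow_succ']

theorem hlQOne_oneRow_succ (t b : ℝ) (n : ℕ) :
    hlQOne t (oneRow (n + 1)) ⊥ b = (1 - t) * b ^ (n + 1) := by
  induction n with
  | zero =>
    rw [hlQOne_eq_dropCol, dropCol_oneRow_succ, dropCol_bot, oneRow, hlQOne_self_bot]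
    have : (oneRow 1).colLen 1 = 0 := by rw [← colLen_dropCol, dropCol_oneRow_succ]; simp [oneRow]
    simp [this, mul_comm]
  | succ n ih =>
    rw [hlQOne_eq_dropCol, dropCol_oneRow_succ, dropCol_bot, ih]
    have : (oneRow (n + 1 + 1)).colLen 1 = 1 := by
      rw [← colLen_dropCol, dropCol_oneRow_succ]; simp
    simp [this]
    ring

/-- A diagram with one part is a row, so this is a geometric series. It is the only genuinely
infinite sum to be evaluated, and it is where `|ab| < 1` enters. All other values of the refined
sums come from finite linear combinations. -/
theorem hasSum_cauchyUp_bot_one {t a b : ℝ} (hz : |a * b| < 1) :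
    HasSum (cauchyUp t a b ⊥ ⊥ 1) ((1 - t) * (a * b) / (1 - a * b)) := by
  have hinj : Function.Injective fun n => oneRow (n + 1) := fun m n h => by
    have := oneRow_injective h; omega
  rw [← hinj.hasSum_iff]
  · have := (hasSum_geometric_of_abs_lt_one hz).mul_left ((1 - t) * (a * b))
    rw [← div_eq_mul_inv] at this
    refine this.congr_fun fun n => ?_
    simp only [Function.comp, cauchyUp, colLen_oneRow_succ, if_true, hlPOne_oneRow,
      hlQOne_oneRow_succ, mul_pow]
    ring
  · intro nu hnu
    rw [cauchyUp, if_neg]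
    intro h1
    obtain ⟨n, rfl⟩ := exists_eq_oneRow h1.le
    rcases n with _ | n
    · simp [oneRow] at h1
    · exact hnu ⟨n, rfl⟩

/-! ### Recursion of the refined sums in the first column -/

/-- The factor of `P_{ν/λ}(a) Q_{ν/μ}(b)` that comes from the first column, where `ν`, `λ`, `μ` have
first two columns `(r, s)`, `(l, l₂)`, `(m, m₂)`. -/
noncomputable def upFactor (t a b : ℝ) (l l₂ m m₂ r s : ℕ) : ℝ :=
  if s ≤ r then
    (a ^ (r - l) * if r - s + 1 = l - l₂ then 1 - t ^ (l - l₂) else 1) *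
      (b ^ (r - m) * if r - s = m - m₂ + 1 then 1 - t ^ (r - s) else 1)
  else 0

/-- The factor of `P_{μ/κ}(a) Q_{λ/κ}(b)` that comes from the first column, where `κ`, `λ`, `μ` have
first two columns `(r - 1, s - 1)`, `(l, l₂)`, `(m, m₂)`. -/
noncomputable def downFactor (t a b : ℝ) (l l₂ m m₂ r s : ℕ) : ℝ :=
  if s ≤ r then
    (a ^ (m + 1 - r) * if m - m₂ + 1 = r - s then 1 - t ^ (r - s) else 1) *
      (b ^ (l + 1 - r) * if l - l₂ = r - s + 1 then 1 - t ^ (l - l₂) else 1)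
  else 0

/-- The values that the first column `r` of `ν`, respectively `r - 1` of `κ`, may take. -/
def ColRange (l m r : ℕ) : Prop := (l ≤ r ∧ r ≤ l + 1) ∧ m ≤ r ∧ r ≤ m + 1

theorem cauchyUp_eq_zero {t a b : ℝ} {lam mu : YoungDiagram} {r : ℕ}
    (h : ¬ ColRange (lam.colLen 0) (mu.colLen 0) r) (nu : YoungDiagram) :
    cauchyUp t a b lam mu r nu = 0 := by
  unfold cauchyUp
  split_ifs with hr
  · by_contra hne
    subst hr
    exact h ⟨hlPOne_colLen_of_ne_zero (left_ne_zero_of_mul hne),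
      hlQOne_colLen_of_ne_zero (right_ne_zero_of_mul hne)⟩
  · rfl

theorem cauchyDown_eq_zero {t a b : ℝ} {lam mu : YoungDiagram} {r : ℕ}
    (h : ¬ ColRange (lam.colLen 0) (mu.colLen 0) r) (ka : YoungDiagram) :
    cauchyDown t a b lam mu r ka = 0 := by
  unfold cauchyDown
  split_ifs with hr
  · by_contra hne
    subst hr
    have h1 := hlPOne_colLen_of_ne_zero (left_ne_zero_of_mul hne)
    have h2 := hlQOne_colLen_of_ne_zero (right_ne_zero_of_mul hne)
    exact h ⟨⟨by omega, by omega⟩, by omega, by omega⟩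
  · rfl

/-- Transport along the bijection `dropColEquiv`: a diagram with `r` parts is the same as an
arbitrary diagram with at most `r` parts. -/
theorem hasSum_of_fiber {f g : YoungDiagram → ℝ} {r : ℕ} {V : ℝ}
    (hf : ∀ nu, nu.colLen 0 ≠ r → f nu = 0) (hg : ∀ nu, r < nu.colLen 0 → g nu = 0)
    (hfg : ∀ nu, nu.colLen 0 = r → f nu = g nu.dropCol) (h : HasSum g V) : HasSum f V := by
  have h1 : HasSum (g ∘ ((↑) : {nu : YoungDiagram | nu.colLen 0 ≤ r} → YoungDiagram)) V := by
    rw [hasSum_subtype_iff_of_support_subset]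
    · exact h
    · intro nu hnu
      by_contra hlt
      exact hnu (hg nu (by simpa using hlt))
  have h2 : HasSum (f ∘ ((↑) : {nu : YoungDiagram | nu.colLen 0 = r} → YoungDiagram)) V := by
    have h1' := (dropColEquiv r).hasSum_iff.2 h1
    refine h1'.congr_fun fun nu => ?_
    exact hfg nu.1 nu.2
  rwa [hasSum_subtype_iff_of_support_subset] at h2
  intro nu hnu
  by_contra hne
  exact hnu (hf nu hne)

/-- Interlacing with `λ` leaves only the two values `λ'_2` and `λ'_2 + 1` for the second column of
`ν`. On each of these classes the first-column factor is constant and can be pulled out of the sum.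
-/
theorem hasSum_cauchyUp_of_dropCol {t a b : ℝ} {lam mu : YoungDiagram} {U : ℕ → ℝ}
    (hU : ∀ s, HasSum (cauchyUp t a b lam.dropCol mu.dropCol s) (U s)) {r : ℕ}
    (hr : ColRange (lam.colLen 0) (mu.colLen 0) r) :
    HasSum (cauchyUp t a b lam mu r)
      (upFactor t a b (lam.colLen 0) (lam.colLen 1) (mu.colLen 0) (mu.colLen 1) r (lam.colLen 1) *
          U (lam.colLen 1) +
        upFactor t a b (lam.colLen 0) (lam.colLen 1) (mu.colLen 0) (mu.colLen 1) r
          (lam.colLen 1 + 1) * U (lam.colLen 1 + 1)) := by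
  refine hasSum_of_fiber (r := r) ?_ ?_ ?_ (((hU _).mul_left _).add ((hU _).mul_left _))
  · intro nu h; exact if_neg h
  · intro nu h
    have hz : ∀ s, upFactor t a b (lam.colLen 0) (lam.colLen 1) (mu.colLen 0) (mu.colLen 1) r s *
        cauchyUp t a b lam.dropCol mu.dropCol s nu = 0 := fun s => by
      by_cases hs : nu.colLen 0 = s
      · rw [upFactor, if_neg (by omega), zero_mul]
      · rw [cauchyUp, if_neg hs, mul_zero]
    simp only [hz, add_zero]
  · intro nu h
    have hs : nu.colLen 1 ≤ nu.colLen 0 := nu.colLen_anti _ _ (by omega)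
    obtain ⟨⟨hr1, hr2⟩, hr3, hr4⟩ := hr
    simp only [cauchyUp]
    rw [if_pos h, hlPOne_eq_dropCol, hlQOne_eq_dropCol,
      if_pos (⟨by omega, by omega⟩ : lam.colLen 0 ≤ nu.colLen 0 ∧ nu.colLen 0 ≤ lam.colLen 0 + 1),
      if_pos (⟨by omega, by omega⟩ : mu.colLen 0 ≤ nu.colLen 0 ∧ nu.colLen 0 ≤ mu.colLen 0 + 1)]
    by_cases hne : hlPOne t nu.dropCol lam.dropCol a = 0
    · simp [hne]
    · have h3 := hlPOne_colLen_of_ne_zero hne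
      simp only [colLen_dropCol, zero_add] at h3 ⊢
      rcases (by omega : nu.colLen 1 = lam.colLen 1 ∨ nu.colLen 1 = lam.colLen 1 + 1) with h4 | h4
      · rw [if_pos h4, if_neg (by omega : ¬ nu.colLen 1 = lam.colLen 1 + 1), mul_zero, add_zero,
          upFactor, if_pos (by omega : lam.colLen 1 ≤ r), h, h4]
        ring
      · rw [if_pos h4, if_neg (by omega : ¬ nu.colLen 1 = lam.colLen 1), mul_zero, zero_add,
          upFactor, if_pos (by omega : lam.colLen 1 + 1 ≤ r), h, h4]
        ring

/-- The same splitting for `κ`, whose second column is `λ'_2 - 1` or `λ'_2`. The shift of `r` and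
`s` by one makes both recursions run over the same indices. -/
theorem hasSum_cauchyDown_of_dropCol {t a b : ℝ} {lam mu : YoungDiagram} {D : ℕ → ℝ}
    (hD : ∀ s, HasSum (cauchyDown t a b lam.dropCol mu.dropCol s) (D s)) {r : ℕ}
    (hr : ColRange (lam.colLen 0) (mu.colLen 0) r) :
    HasSum (cauchyDown t a b lam mu r)
      (downFactor t a b (lam.colLen 0) (lam.colLen 1) (mu.colLen 0) (mu.colLen 1) r
          (lam.colLen 1) * D (lam.colLen 1) +
        downFactor t a b (lam.colLen 0) (lam.colLen 1) (mu.colLen 0) (mu.colLen 1) r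
          (lam.colLen 1 + 1) * D (lam.colLen 1 + 1)) := by
  have hz : ∀ ka : YoungDiagram, r < ka.colLen 0 + 1 → ∀ s,
      downFactor t a b (lam.colLen 0) (lam.colLen 1) (mu.colLen 0) (mu.colLen 1) r s *
        cauchyDown t a b lam.dropCol mu.dropCol s ka = 0 := fun ka h s => by
    by_cases hs : ka.colLen 0 + 1 = s
    · rw [downFactor, if_neg (by omega), zero_mul]
    · rw [cauchyDown, if_neg hs, mul_zero]
  refine hasSum_of_fiber (r := r - 1) ?_ ?_ ?_ (((hD _).mul_left _).add ((hD _).mul_left _))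
  · intro ka h; exact if_neg (by omega)
  · intro ka h
    simp only [hz ka (by omega), add_zero]
  · intro ka h
    have hs : ka.colLen 1 ≤ ka.colLen 0 := ka.colLen_anti _ _ (by omega)
    -- For `r = 0` no `κ` is admissible, although the truncated `r - 1` points to the fiber over
    -- `0`. Both sides vanish there.
    rcases Nat.eq_zero_or_pos r with rfl | hr0
    · simp only [hz ka.dropCol (by omega), add_zero]
      exact if_neg (by omega)
    obtain ⟨⟨hr1, hr2⟩, hr3, hr4⟩ := hr
    simp only [cauchyDown]
    rw [if_pos (by omega : ka.colLen 0 + 1 = r), hlPOne_eq_dropCol, hlQOne_eq_dropCol,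
      if_pos (⟨by omega, by omega⟩ : ka.colLen 0 ≤ mu.colLen 0 ∧ mu.colLen 0 ≤ ka.colLen 0 + 1),
      if_pos (⟨by omega, by omega⟩ : ka.colLen 0 ≤ lam.colLen 0 ∧ lam.colLen 0 ≤ ka.colLen 0 + 1)]
    by_cases hne : hlQOne t lam.dropCol ka.dropCol b = 0
    · simp [hne]
    · have h3 := hlQOne_colLen_of_ne_zero hne
      simp only [colLen_dropCol, zero_add] at h3 ⊢
      have e1 : mu.colLen 0 + 1 - r = mu.colLen 0 - ka.colLen 0 := by omega
      have e2 : lam.colLen 0 + 1 - r = lam.colLen 0 - ka.colLen 0 := by omega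
      rcases (by omega : ka.colLen 1 + 1 = lam.colLen 1 ∨ ka.colLen 1 = lam.colLen 1) with h4 | h4
      · have e3 : r - lam.colLen 1 = ka.colLen 0 - ka.colLen 1 := by omega
        rw [if_pos h4, if_neg (by omega : ¬ ka.colLen 1 + 1 = lam.colLen 1 + 1), mul_zero, add_zero,
          downFactor, if_pos (by omega : lam.colLen 1 ≤ r), e1, e2, e3]
        ring
      · have e3 : r - (lam.colLen 1 + 1) = ka.colLen 0 - ka.colLen 1 := by omega
        rw [if_neg (by omega : ¬ ka.colLen 1 + 1 = lam.colLen 1),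
          if_pos (by omega : ka.colLen 1 + 1 = lam.colLen 1 + 1), mul_zero, zero_add, downFactor,
          if_pos (by omega : lam.colLen 1 + 1 ≤ r), e1, e2, e3]
        ring

/-- Here `p` and `q` are the multiplicities of the part `1` in `λ` and `μ`, and `i`, `j` are `r -
l`, `r - m`. In this group of lemmas, low and high mean `s = l₂` and `s = l₂ + 1`, while zero and
one give the value of `i`. The factors then depend on `p`, `q`, `i`, `j` only. -/
theorem upFactor_low (t a b : ℝ) {l l₂ m m₂ r p q i j : ℕ} (hl : l = l₂ + p) (hm : m = m₂ + q)
    (hi : r = l + i) (hj : r = m + j) :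
    upFactor t a b l l₂ m m₂ r l₂ =
      a ^ i * (b ^ j * if p + i = q + 1 then 1 - t ^ (p + i) else 1) := by
  have e1 : r - l = i := by omega
  have e2 : r - m = j := by omega
  have e3 : r - l₂ = p + i := by omega
  have e4 : l - l₂ = p := by omega
  have e5 : m - m₂ = q := by omega
  rw [upFactor, if_pos (by omega), e1, e2, e3, e4, e5, if_neg (by omega : ¬ p + i + 1 = p), mul_one]

theorem upFactor_high_zero (t a b : ℝ) {l l₂ m m₂ p q j : ℕ} (hl : l = l₂ + p) (hm : m = m₂ + q)
    (hj : l = m + j) :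
    upFactor t a b l l₂ m m₂ l (l₂ + 1) =
      (1 - t ^ p) * (b ^ j * if p = q + 2 then 1 - t ^ (q + 1) else 1) := by
  -- For `p = 0` the second column `l₂ + 1` would exceed the first column `l`. The factor `1 - t ^ 0
  -- = 0` accounts for this.
  rcases p with _ | p
  · rw [upFactor, if_neg (by omega)]; simp
  have e1 : l - l = 0 := by omega
  have e2 : l - m = j := by omega
  have e3 : l - (l₂ + 1) = p := by omega
  have e4 : l - l₂ = p + 1 := by omega
  have e5 : m - m₂ = q := by omega
  rw [upFactor, if_pos (by omega), e1, e2, e3, e4, e5, if_pos rfl, pow_zero, one_mul]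
  by_cases h : p = q + 1
  · rw [if_pos h, if_pos (by omega), h]
  · rw [if_neg h, if_neg (by omega)]

theorem upFactor_high_one (t a b : ℝ) {l l₂ m m₂ r p q j : ℕ} (hl : l = l₂ + p) (hm : m = m₂ + q)
    (hi : r = l + 1) (hj : r = m + j) :
    upFactor t a b l l₂ m m₂ r (l₂ + 1) =
      a * (b ^ j * if p = q + 1 then 1 - t ^ p else 1) := by
  have e1 : r - l = 1 := by omega
  have e2 : r - m = j := by omega
  have e3 : r - (l₂ + 1) = p := by omega
  have e4 : l - l₂ = p := by omega
  have e5 : m - m₂ = q := by omega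
  rw [upFactor, if_pos (by omega), e1, e2, e3, e4, e5, if_neg (by omega : ¬ p + 1 = p), mul_one,
    pow_one]

theorem downFactor_low (t a b : ℝ) {l l₂ m m₂ r p q i j : ℕ} (hl : l = l₂ + p) (hm : m = m₂ + q)
    (hi : r = l + i) (hj : r = m + j) :
    downFactor t a b l l₂ m m₂ r l₂ =
      a ^ (1 - j) * (if q + 1 = p + i then 1 - t ^ (p + i) else 1) * b ^ (1 - i) := by
  have e1 : m + 1 - r = 1 - j := by omega
  have e2 : l + 1 - r = 1 - i := by omega
  have e3 : r - l₂ = p + i := by omega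
  have e4 : l - l₂ = p := by omega
  have e5 : m - m₂ = q := by omega
  rw [downFactor, if_pos (by omega), e1, e2, e3, e4, e5, if_neg (by omega : ¬ p = p + i + 1),
    mul_one]

theorem downFactor_high_zero (t a b : ℝ) {l l₂ m m₂ p q j : ℕ} (hl : l = l₂ + p) (hm : m = m₂ + q)
    (hj : l = m + j) :
    downFactor t a b l l₂ m m₂ l (l₂ + 1) =
      a ^ (1 - j) * (if p = q + 2 then 1 - t ^ (q + 1) else 1) * (b * (1 - t ^ p)) := by
  rcases p with _ | p
  · rw [downFactor, if_neg (by omega)]; simp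
  have e1 : m + 1 - l = 1 - j := by omega
  have e2 : l + 1 - l = 1 := by omega
  have e3 : l - (l₂ + 1) = p := by omega
  have e4 : l - l₂ = p + 1 := by omega
  have e5 : m - m₂ = q := by omega
  rw [downFactor, if_pos (by omega), e1, e2, e3, e4, e5, if_pos rfl, pow_one]
  by_cases h : q + 1 = p
  · rw [if_pos h, if_pos (by omega), h]
  · rw [if_neg h, if_neg (by omega)]

theorem downFactor_high_one (t a b : ℝ) {l l₂ m m₂ r p q j : ℕ} (hl : l = l₂ + p)
    (hm : m = m₂ + q) (hi : r = l + 1) (hj : r = m + j) :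
    downFactor t a b l l₂ m m₂ r (l₂ + 1) =
      a ^ (1 - j) * (if q + 1 = p then 1 - t ^ p else 1) := by
  have e1 : m + 1 - r = 1 - j := by omega
  have e2 : l + 1 - r = 0 := by omega
  have e3 : r - (l₂ + 1) = p := by omega
  have e4 : l - l₂ = p := by omega
  have e5 : m - m₂ = q := by omega
  rw [downFactor, if_pos (by omega), e1, e2, e3, e4, e5, if_neg (by omega : ¬ p = p + 1), mul_one,
    pow_zero, mul_one]

/-! ### The refined skew Cauchy identity -/

/-- The refined skew Cauchy identity between the values `U r = ∑_ν P_{ν/λ}(a) Q_{ν/μ}(b)` over `ν`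
with `r` parts and `D r = ∑_κ P_{μ/κ}(a) Q_{λ/κ}(b)` over `κ` with `r - 1` parts, where `λ` has `l`
and `μ` has `m` parts and `z = a b`. -/
structure RefinedCauchy (t z : ℝ) (l m : ℕ) (U D : ℕ → ℝ) : Prop where
  up_zero : ∀ r, ¬ ColRange l m r → U r = 0
  down_zero : ∀ r, ¬ ColRange l m r → D r = 0
  down_at_zero : D 0 = 0
  eq_low : l = m → U l = D (l + 1) + (1 - t) / (1 - z) * D l
  eq_high : l = m → U (l + 1) = (1 - t) * z / (1 - z) * D (l + 1) + t * D l
  eq_left : l = m + 1 → U l = (1 - t * z) / (1 - z) * D l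
  eq_right : m = l + 1 → U m = (1 - t * z) / (1 - z) * D m

-- When `l = m` the relations say that `(U l, U (l + 1))` is the image of `(D l, D (l + 1))` under a
-- 2×2 matrix independent of `λ` and `μ`; when `l` and `m` differ by one they are a scalar relation.
-- The recursions by first-column factors are compatible with these maps. What remains in each case
-- is a rational identity in `a`, `b`, `t` and a power of `t`.
open Classical in
theorem RefinedCauchy.step {t a b : ℝ} (hz : a * b ≠ 1) {l m l₂ m₂ : ℕ} (hl : l₂ ≤ l) (hm : m₂ ≤ m)
    {U D : ℕ → ℝ} (h : RefinedCauchy t (a * b) l₂ m₂ U D) :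
    RefinedCauchy t (a * b) l m
      (fun r => if ColRange l m r then upFactor t a b l l₂ m m₂ r l₂ * U l₂ +
        upFactor t a b l l₂ m m₂ r (l₂ + 1) * U (l₂ + 1) else 0)
      (fun r => if ColRange l m r then downFactor t a b l l₂ m m₂ r l₂ * D l₂ +
        downFactor t a b l l₂ m m₂ r (l₂ + 1) * D (l₂ + 1) else 0) := by
  have hz' : 1 - a * b ≠ 0 := sub_ne_zero.2 hz.symm
  have hz'' : 1 - b * a ≠ 0 := by rwa [mul_comm b a]
  obtain ⟨p, hp⟩ := Nat.exists_eq_add_of_le hl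
  obtain ⟨q, hq⟩ := Nat.exists_eq_add_of_le hm
  -- Only the values at `l₂` and `l₂ + 1` enter, and they vanish unless the second columns differ by
  -- at most one. The position of `l₂` relative to `m₂`, together with that of `l` relative to `m`,
  -- fixes `p - q` and thereby decides the conditions in the factors, up to small values of `p` and
  -- `q`.
  have cases2 : l₂ = m₂ ∨ (l₂ = m₂ + 1 ∧ U (l₂ + 1) = 0 ∧ D (l₂ + 1) = 0) ∨
      (m₂ = l₂ + 1 ∧ U l₂ = 0 ∧ D l₂ = 0) ∨ (U l₂ = 0 ∧ U (l₂ + 1) = 0 ∧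
      D l₂ = 0 ∧ D (l₂ + 1) = 0) := by
    by_cases h1 : l₂ = m₂
    · exact Or.inl h1
    by_cases h2 : l₂ = m₂ + 1
    · exact Or.inr (Or.inl ⟨h2, h.up_zero _ (by unfold ColRange; omega),
        h.down_zero _ (by unfold ColRange; omega)⟩)
    by_cases h3 : m₂ = l₂ + 1
    · exact Or.inr (Or.inr (Or.inl ⟨h3, h.up_zero _ (by unfold ColRange; omega),
        h.down_zero _ (by unfold ColRange; omega)⟩))
    refine Or.inr (Or.inr (Or.inr ⟨h.up_zero _ ?_, h.up_zero _ ?_, h.down_zero _ ?_,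
      h.down_zero _ ?_⟩)) <;> (unfold ColRange; omega)
  refine ⟨fun r hr => if_neg hr, fun r hr => if_neg hr, ?_, ?_, ?_, ?_, ?_⟩
  · split_ifs with hr
    · unfold ColRange at hr
      obtain rfl : l₂ = 0 := by omega
      rw [h.down_at_zero, downFactor, downFactor, if_neg (by omega : ¬ 0 + 1 ≤ 0)]
      simp
    · rfl
  · intro e
    rw [if_pos (by unfold ColRange; omega), if_pos (by unfold ColRange; omega),
      if_pos (by unfold ColRange; omega),
      upFactor_low t a b hp hq (i := 0) (j := 0) (by omega) (by omega),
      upFactor_high_zero t a b hp hq (j := 0) (by omega),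
      downFactor_low t a b hp hq (i := 1) (j := 1) (by omega) (by omega),
      downFactor_low t a b hp hq (i := 0) (j := 0) (by omega) (by omega),
      downFactor_high_one t a b hp hq (j := 1) (by omega) (by omega),
      downFactor_high_zero t a b hp hq (j := 0) (by omega)]
    rcases cases2 with c | ⟨c, z1, z2⟩ | ⟨c, z1, z2⟩ | ⟨z1, z2, z3, z4⟩
    · obtain rfl : p = q := by omega
      rw [h.eq_low c, h.eq_high c]
      split_ifs <;> first
        | omega
        | (simp; field_simp; ring)
    · obtain rfl : q = p + 1 := by omega
      rw [h.eq_left c, z1, z2]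
      split_ifs <;> first
        | omega
        | (simp; field_simp; ring)
    · obtain rfl : p = q + 1 := by omega
      have := h.eq_right c
      rw [c] at this
      rw [this, z1, z2]
      split_ifs <;> first
        | omega
        | (simp; field_simp; ring)
    · simp [z1, z2, z3, z4]
  · intro e
    rw [if_pos (by unfold ColRange; omega), if_pos (by unfold ColRange; omega),
      if_pos (by unfold ColRange; omega),
      upFactor_low t a b hp hq (i := 1) (j := 1) (by omega) (by omega),
      upFactor_high_one t a b hp hq (j := 1) (by omega) (by omega),
      downFactor_low t a b hp hq (i := 1) (j := 1) (by omega) (by omega),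
      downFactor_low t a b hp hq (i := 0) (j := 0) (by omega) (by omega),
      downFactor_high_one t a b hp hq (j := 1) (by omega) (by omega),
      downFactor_high_zero t a b hp hq (j := 0) (by omega)]
    rcases cases2 with c | ⟨c, z1, z2⟩ | ⟨c, z1, z2⟩ | ⟨z1, z2, z3, z4⟩
    · obtain rfl : p = q := by omega
      rw [h.eq_low c, h.eq_high c]
      split_ifs <;> first
        | omega
        | (simp; field_simp; ring)
    · obtain rfl : q = p + 1 := by omega
      rw [h.eq_left c, z1, z2]
      split_ifs <;> first
        | omega
        | (simp; field_simp; ring)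
    · obtain rfl : p = q + 1 := by omega
      have := h.eq_right c
      rw [c] at this
      rw [this, z1, z2]
      split_ifs <;> first
        | omega
        | (simp; field_simp; ring)
    · simp [z1, z2, z3, z4]
  · intro e
    rw [if_pos (by unfold ColRange; omega), if_pos (by unfold ColRange; omega),
      upFactor_low t a b hp hq (i := 0) (j := 1) (by omega) (by omega),
      upFactor_high_zero t a b hp hq (j := 1) (by omega),
      downFactor_low t a b hp hq (i := 0) (j := 1) (by omega) (by omega),
      downFactor_high_zero t a b hp hq (j := 1) (by omega)]
    rcases cases2 with c | ⟨c, z1, z2⟩ | ⟨c, z1, z2⟩ | ⟨z1, z2, z3, z4⟩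
    · obtain rfl : p = q + 1 := by omega
      rw [h.eq_low c, h.eq_high c]
      split_ifs <;> first
        | omega
        | (simp; field_simp; ring)
    · obtain rfl : p = q := by omega
      rw [h.eq_left c, z1, z2]
      split_ifs <;> first
        | omega
        | (simp; field_simp)
    · obtain rfl : p = q + 2 := by omega
      have := h.eq_right c
      rw [c] at this
      rw [this, z1, z2]
      split_ifs <;> first
        | omega
        | (simp; field_simp)
    · simp [z1, z2, z3, z4]
  · intro e
    rw [if_pos (by unfold ColRange; omega), if_pos (by unfold ColRange; omega),
      upFactor_low t a b hp hq (i := 1) (j := 0) (by omega) (by omega),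
      upFactor_high_one t a b hp hq (j := 0) (by omega) (by omega),
      downFactor_low t a b hp hq (i := 1) (j := 0) (by omega) (by omega),
      downFactor_high_one t a b hp hq (j := 0) (by omega) (by omega)]
    rcases cases2 with c | ⟨c, z1, z2⟩ | ⟨c, z1, z2⟩ | ⟨z1, z2, z3, z4⟩
    · obtain rfl : q = p + 1 := by omega
      rw [h.eq_low c, h.eq_high c]
      split_ifs <;> first
        | omega
        | (simp; field_simp; ring)
    · obtain rfl : q = p + 2 := by omega
      rw [h.eq_left c, z1, z2]
      split_ifs <;> first
        | omega
        | (simp; field_simp)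
    · obtain rfl : p = q := by omega
      have := h.eq_right c
      rw [c] at this
      rw [this, z1, z2]
      split_ifs <;> first
        | omega
        | (simp; field_simp)
    · simp [z1, z2, z3, z4]

theorem hasSum_cauchyUp_bot_zero (t a b : ℝ) : HasSum (cauchyUp t a b ⊥ ⊥ 0) 1 := by
  have h : cauchyUp t a b ⊥ ⊥ 0 ⊥ = 1 := by
    simp [cauchyUp, hlPOne_self_bot, hlQOne_self_bot]
  rw [← h]
  refine hasSum_single _ fun nu hnu => if_neg fun h0 => hnu (eq_bot_of_colLen h0)

theorem hasSum_cauchyDown_bot_one (t a b : ℝ) : HasSum (cauchyDown t a b ⊥ ⊥ 1) 1 := by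
  have h : cauchyDown t a b ⊥ ⊥ 1 ⊥ = 1 := by
    simp [cauchyDown, hlPOne_self_bot, hlQOne_self_bot]
  rw [← h]
  refine hasSum_single _ fun nu hnu => if_neg fun h0 => hnu (eq_bot_of_colLen (by omega))

theorem hasSum_of_forall_eq_zero {ι : Type*} {f : ι → ℝ} (h : ∀ i, f i = 0) : HasSum f 0 := by
  rw [funext h]; exact hasSum_zero

-- Induction on `|λ| + |μ|`, which drops when the first columns are removed unless both diagrams are
-- empty. For `λ = μ = ∅` the only `κ` is `∅`, and `ν` is empty or a single row.
open Classical in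
theorem exists_refinedCauchy {t a b : ℝ} (hz : |a * b| < 1) (lam mu : YoungDiagram) :
    ∃ U D : ℕ → ℝ, (∀ r, HasSum (cauchyUp t a b lam mu r) (U r)) ∧
      (∀ r, HasSum (cauchyDown t a b lam mu r) (D r)) ∧
      RefinedCauchy t (a * b) (lam.colLen 0) (mu.colLen 0) U D := by
  have hz1 : a * b ≠ 1 := fun h => by simp [h] at hz
  induction hn : lam.card + mu.card using Nat.strong_induction_on generalizing lam mu with
  | _ n ih =>
    by_cases h0 : lam.colLen 0 = 0 ∧ mu.colLen 0 = 0
    · obtain rfl := eq_bot_of_colLen h0.1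
      obtain rfl := eq_bot_of_colLen h0.2
      refine ⟨fun r => if r = 0 then 1 else if r = 1 then (1 - t) * (a * b) / (1 - a * b) else 0,
        fun r => if r = 1 then 1 else 0, fun r => ?_, fun r => ?_, ?_⟩
      · dsimp only
        split_ifs with h1 h2
        · rw [h1]; exact hasSum_cauchyUp_bot_zero t a b
        · rw [h2]; exact hasSum_cauchyUp_bot_one hz
        · exact hasSum_of_forall_eq_zero
            (cauchyUp_eq_zero (by simp only [colLen_bot, ColRange]; omega))
      · dsimp only
        split_ifs with h1
        · rw [h1]; exact hasSum_cauchyDown_bot_one t a b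
        · refine hasSum_of_forall_eq_zero fun ka => ?_
          rcases Nat.eq_zero_or_pos r with rfl | hr
          · exact if_neg (by omega)
          · exact cauchyDown_eq_zero (by simp only [colLen_bot, ColRange]; omega) ka
      · constructor <;> simp [ColRange]
        · intro r h1
          rw [if_neg (by omega), if_neg (by omega)]
        · omega
    · have c1 := card_eq_colLen_add_card_dropCol lam
      have c2 := card_eq_colLen_add_card_dropCol mu
      obtain ⟨U, D, hU, hD, h⟩ := ih _ (by omega) lam.dropCol mu.dropCol rfl
      simp only [colLen_dropCol, zero_add] at h
      refine ⟨_, _, fun r => ?_, fun r => ?_,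
        h.step hz1 (lam.colLen_anti 0 1 (by omega)) (mu.colLen_anti 0 1 (by omega))⟩
      · split_ifs with hr
        · exact hasSum_cauchyUp_of_dropCol hU hr
        · exact hasSum_of_forall_eq_zero (cauchyUp_eq_zero hr)
      · split_ifs with hr
        · exact hasSum_cauchyDown_of_dropCol hD hr
        · exact hasSum_of_forall_eq_zero (cauchyDown_eq_zero hr)

/-! ### The refined identity in terms of vertex weights -/

section vertexWeight

variable {t z s : ℝ}

/-- Under the matching of parameters `z = ab` equals `1 / (√t s)`. In terms of `z` the square roots
disappear and the weights become rational functions of `t` and `z` with common denominator `1 - tz`.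
-/
theorem vertexWeight_params (ht : 0 < t) (hz : z * (√t * s) = 1) :
    s ≠ 0 ∧ 1 / √t * s = 1 / (t * z) ∧ √t * s = 1 / z := by
  have hr : √t ≠ 0 := (Real.sqrt_pos.2 ht).ne'
  have hsq : √t * √t = t := Real.mul_self_sqrt ht.le
  have hz0 : z ≠ 0 := left_ne_zero_of_mul_eq_one hz
  refine ⟨right_ne_zero_of_mul (right_ne_zero_of_mul_eq_one hz), ?_, ?_⟩
  · rw [div_mul_eq_mul_div, one_mul, div_eq_div_iff hr (mul_ne_zero ht.ne' hz0)]
    linear_combination √t * hz - s * z * hsq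
  · field_simp
    linear_combination hz

theorem vertexWeight_right_right (ht : 0 < t) (hz : z * (√t * s) = 1) (hz1 : t * z ≠ 1) :
    vertexWeight t s (true, false) (true, false) = (1 - z) / (1 - t * z) := by
  obtain ⟨-, h1, -⟩ := vertexWeight_params ht hz
  have hz0 : z ≠ 0 := left_ne_zero_of_mul_eq_one hz
  have h2 : 1 - t * z ≠ 0 := sub_ne_zero.2 hz1.symm
  have h3 : t * z - 1 ≠ 0 := sub_ne_zero.2 hz1
  simp only [vertexWeight]
  rw [h1]
  field_simp
  ring

theorem vertexWeight_right_up (ht : 0 < t) (hz : z * (√t * s) = 1) (hz1 : t * z ≠ 1) :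
    vertexWeight t s (true, false) (false, true) = (1 - t) * z / (1 - t * z) := by
  obtain ⟨-, h1, -⟩ := vertexWeight_params ht hz
  have hz0 : z ≠ 0 := left_ne_zero_of_mul_eq_one hz
  have h2 : 1 - t * z ≠ 0 := sub_ne_zero.2 hz1.symm
  have h3 : t * z - 1 ≠ 0 := sub_ne_zero.2 hz1
  simp only [vertexWeight]
  rw [h1]
  field_simp
  ring

theorem vertexWeight_up_up (ht : 0 < t) (hz : z * (√t * s) = 1) (hz1 : t * z ≠ 1) :
    vertexWeight t s (false, true) (false, true) = t * (1 - z) / (1 - t * z) := by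
  obtain ⟨-, h1, h0⟩ := vertexWeight_params ht hz
  have hz0 : z ≠ 0 := left_ne_zero_of_mul_eq_one hz
  have h2 : 1 - t * z ≠ 0 := sub_ne_zero.2 hz1.symm
  have h3 : t * z - 1 ≠ 0 := sub_ne_zero.2 hz1
  simp only [vertexWeight]
  have h4 : 1 - 1 / (t * z) = -(1 - t * z) / (t * z) := by field_simp; ring
  rw [h1, h0, h4]
  field_simp
  ring

theorem vertexWeight_up_right (ht : 0 < t) (hz : z * (√t * s) = 1) (hz1 : t * z ≠ 1) :
    vertexWeight t s (false, true) (true, false) = (1 - t) / (1 - t * z) := by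
  obtain ⟨-, h1, -⟩ := vertexWeight_params ht hz
  have hz0 : z ≠ 0 := left_ne_zero_of_mul_eq_one hz
  have h2 : 1 - t * z ≠ 0 := sub_ne_zero.2 hz1.symm
  have h3 : t * z - 1 ≠ 0 := sub_ne_zero.2 hz1
  simp only [vertexWeight]
  rw [mul_assoc, h1]
  field_simp
  ring

end vertexWeight

/-- The skew Cauchy identity refined by the first columns, with the vertex weights of the stochastic
six vertex model: `right`, `top` record whether `ν` has as many parts as `μ`, and one more part
than `λ`. -/
theorem exists_hasSum_vertexWeight {t a b s : ℝ} (ht : 0 < t) (ht1 : t < 1) (hz0 : 0 ≤ a * b)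
    (hz1 : a * b < 1) (hs : a * b * (√t * s) = 1) (lam mu : YoungDiagram) (right top : Bool) :
    ∃ V, HasSum (fun ka : YoungDiagram =>
        vertexWeight t s (decide (lam.colLen 0 = ka.colLen 0), decide (mu.colLen 0 = ka.colLen 0 + 1))
          (right, top) * (hlPOne t mu ka a * hlQOne t lam ka b)) V ∧
      HasSum (fun nu : YoungDiagram =>
        if decide (nu.colLen 0 = lam.colLen 0 + 1) = top ∧ decide (nu.colLen 0 = mu.colLen 0) = right
        then hlPOne t nu lam a * hlQOne t nu mu b else 0)
        ((1 - t * a * b) / (1 - a * b) * V) := by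
  obtain ⟨U, D, hU, hD, h⟩ := exists_refinedCauchy (t := t) (a := a) (b := b)
    (by rwa [abs_of_nonneg hz0]) lam mu
  have htz : t * (a * b) < 1 := by nlinarith
  have e1 : 1 - a * b ≠ 0 := by linarith
  have e2 : 1 - t * (a * b) ≠ 0 := by linarith
  have e3 : t * a * b = t * (a * b) := mul_assoc _ _ _
  have e4 : 1 - t * a * b ≠ 0 := by rwa [e3]
  have hup : ∀ nu, hlPOne t nu lam a * hlQOne t nu mu b = 0 ∨
      ((lam.colLen 0 ≤ nu.colLen 0 ∧ nu.colLen 0 ≤ lam.colLen 0 + 1) ∧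
        mu.colLen 0 ≤ nu.colLen 0 ∧ nu.colLen 0 ≤ mu.colLen 0 + 1) := fun nu => by
    by_contra! hne
    have h1 := hlPOne_colLen_of_ne_zero (left_ne_zero_of_mul hne.1)
    have h2 := hlQOne_colLen_of_ne_zero (right_ne_zero_of_mul hne.1)
    have := hne.2 h1
    omega
  have hdown : ∀ ka, hlPOne t mu ka a * hlQOne t lam ka b = 0 ∨
      ((ka.colLen 0 ≤ mu.colLen 0 ∧ mu.colLen 0 ≤ ka.colLen 0 + 1) ∧
        ka.colLen 0 ≤ lam.colLen 0 ∧ lam.colLen 0 ≤ ka.colLen 0 + 1) := fun ka => by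
    by_contra! hne
    have h1 := hlPOne_colLen_of_ne_zero (left_ne_zero_of_mul hne.1)
    have h2 := hlQOne_colLen_of_ne_zero (right_ne_zero_of_mul hne.1)
    have := hne.2 h1
    omega
  -- The relative size of `ℓ(λ)` and `ℓ(μ)` determines the incoming edges. If they agree, `κ` with
  -- `ℓ(λ)` parts means a path from the left and `κ` with `ℓ(λ) - 1` parts one from below; these are
  -- the sums `D (ℓ(λ) + 1)` and `D (ℓ(λ))`. If `ℓ(λ) = ℓ(μ) + 1` both edges are empty, and if `ℓ(μ)
  -- = ℓ(λ) + 1` both are occupied. In all other cases both sums vanish.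
  by_cases c1 : lam.colLen 0 = mu.colLen 0
  · refine ⟨vertexWeight t s (true, false) (right, top) * D (lam.colLen 0 + 1) +
      vertexWeight t s (false, true) (right, top) * D (lam.colLen 0), ?_, ?_⟩
    · refine (((hD _).mul_left _).add ((hD _).mul_left _)).congr_fun fun ka => ?_
      simp only [cauchyDown]
      rcases hdown ka with h0 | h0
      · simp [h0]
      · rcases (by omega : ka.colLen 0 = lam.colLen 0 ∨ ka.colLen 0 + 1 = lam.colLen 0) with h4 | h4
        · simp [h4, ← c1]
        · simp [← h4, ← c1]
    · have hrange : ∀ nu, hlPOne t nu lam a * hlQOne t nu mu b = 0 ∨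
          nu.colLen 0 = lam.colLen 0 ∨ nu.colLen 0 = lam.colLen 0 + 1 := fun nu => by
        rcases hup nu with h0 | h0
        · exact Or.inl h0
        · exact Or.inr (by omega)
      rcases right with _ | _ <;> rcases top with _ | _
      · rw [show vertexWeight t s (true, false) (false, false) = 0 from rfl,
          show vertexWeight t s (false, true) (false, false) = 0 from rfl, zero_mul, zero_mul,
          add_zero, mul_zero]
        refine hasSum_of_forall_eq_zero fun nu => ?_
        rcases hrange nu with h0 | h0 | h0 <;> simp [h0, c1]
      · rw [vertexWeight_right_up ht hs htz.ne, vertexWeight_up_up ht hs htz.ne]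
        have e : (1 - t * a * b) / (1 - a * b) * ((1 - t) * (a * b) / (1 - t * (a * b)) *
            D (lam.colLen 0 + 1) + t * (1 - a * b) / (1 - t * (a * b)) * D (lam.colLen 0)) =
            U (lam.colLen 0 + 1) := by
          rw [h.eq_high c1, e3]; field_simp
        rw [e]
        refine (hU _).congr_fun fun nu => ?_
        simp only [cauchyUp]
        rcases hrange nu with h0 | h0 | h0 <;> simp [h0, c1]
      · rw [vertexWeight_right_right ht hs htz.ne, vertexWeight_up_right ht hs htz.ne]
        have e : (1 - t * a * b) / (1 - a * b) * ((1 - a * b) / (1 - t * (a * b)) *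
            D (lam.colLen 0 + 1) + (1 - t) / (1 - t * (a * b)) * D (lam.colLen 0)) =
            U (lam.colLen 0) := by
          rw [h.eq_low c1, e3]; field_simp
        rw [e]
        refine (hU _).congr_fun fun nu => ?_
        simp only [cauchyUp]
        rcases hrange nu with h0 | h0 | h0 <;> simp [h0, c1]
      · rw [show vertexWeight t s (true, false) (true, true) = 0 from rfl,
          show vertexWeight t s (false, true) (true, true) = 0 from rfl, zero_mul, zero_mul,
          add_zero, mul_zero]
        refine hasSum_of_forall_eq_zero fun nu => ?_
        rcases hrange nu with h0 | h0 | h0 <;> simp [h0, c1]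
  by_cases c2 : lam.colLen 0 = mu.colLen 0 + 1
  · refine ⟨vertexWeight t s (false, false) (right, top) * D (lam.colLen 0), ?_, ?_⟩
    · refine ((hD _).mul_left _).congr_fun fun ka => ?_
      simp only [cauchyDown]
      rcases hdown ka with h0 | h0
      · simp [h0]
      · have h4 : ka.colLen 0 = mu.colLen 0 := by omega
        simp [h4, c2]
    · rw [mul_left_comm, e3, ← h.eq_left c2]
      refine ((hU _).mul_left _).congr_fun fun nu => ?_
      simp only [cauchyUp]
      rcases hup nu with h0 | h0
      · simp [h0]
      · have h4 : nu.colLen 0 = mu.colLen 0 + 1 := by omega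
        rcases right with _ | _ <;> rcases top with _ | _ <;> simp [h4, c2, vertexWeight]
  by_cases c3 : mu.colLen 0 = lam.colLen 0 + 1
  · refine ⟨vertexWeight t s (true, true) (right, top) * D (mu.colLen 0), ?_, ?_⟩
    · refine ((hD _).mul_left _).congr_fun fun ka => ?_
      simp only [cauchyDown]
      rcases hdown ka with h0 | h0
      · simp [h0]
      · have h4 : ka.colLen 0 = lam.colLen 0 := by omega
        simp [h4, c3]
    · rw [mul_left_comm, e3, ← h.eq_right c3]
      refine ((hU _).mul_left _).congr_fun fun nu => ?_
      simp only [cauchyUp]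
      rcases hup nu with h0 | h0
      · simp [h0]
      · have h4 : nu.colLen 0 = lam.colLen 0 + 1 := by omega
        rcases right with _ | _ <;> rcases top with _ | _ <;> simp [h4, c3, vertexWeight]
  refine ⟨0, hasSum_of_forall_eq_zero fun ka => ?_, ?_⟩
  · rcases hdown ka with h0 | h0
    · simp [h0]
    · omega
  · rw [mul_zero]
    refine hasSum_of_forall_eq_zero fun nu => ?_
    rcases hup nu with h0 | h0
    · simp [h0]
    · omega

/-- The local identity with values in `ℝ≥0∞`, where the sums may be interchanged freely. The
nonnegativity of all factors is used here. -/
theorem tsum_vertexWeight {t a b s : ℝ} (ht : 0 < t) (ht1 : t < 1) (ha : 0 ≤ a) (hb : 0 ≤ b)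
    (hz1 : a * b < 1) (hs : a * b * (√t * s) = 1) (hw : ∀ i o, 0 ≤ vertexWeight t s i o)
    (lam mu : YoungDiagram) (right top : Bool) :
    (∑' nu : YoungDiagram,
      (if decide (nu.colLen 0 = lam.colLen 0 + 1) = top then ENNReal.ofReal (hlPOne t nu lam a)
        else 0) *
      if decide (nu.colLen 0 = mu.colLen 0) = right then ENNReal.ofReal (hlQOne t nu mu b) else 0) =
    ENNReal.ofReal ((1 - t * a * b) / (1 - a * b)) * ∑' ka : YoungDiagram,
      ENNReal.ofReal (vertexWeight t s (decide (lam.colLen 0 = ka.colLen 0),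
        decide (mu.colLen 0 = ka.colLen 0 + 1)) (right, top)) *
      (ENNReal.ofReal (hlPOne t mu ka a) * ENNReal.ofReal (hlQOne t lam ka b)) := by
  have hz0 : 0 ≤ a * b := mul_nonneg ha hb
  obtain ⟨V, hV, hU⟩ := exists_hasSum_vertexWeight ht ht1 hz0 hz1 hs lam mu right top
  have hc : 0 ≤ (1 - t * a * b) / (1 - a * b) :=
    div_nonneg (by nlinarith) (by linarith)
  have hP : ∀ nu ka, 0 ≤ hlPOne t nu ka a := fun nu ka => hlPOne_nonneg ht.le ht1.le nu ka ha
  have hQ : ∀ nu ka, 0 ≤ hlQOne t nu ka b := fun nu ka => hlQOne_nonneg ht.le ht1.le nu ka hb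
  calc _ = ∑' nu : YoungDiagram, ENNReal.ofReal (if decide (nu.colLen 0 = lam.colLen 0 + 1) = top ∧
        decide (nu.colLen 0 = mu.colLen 0) = right
        then hlPOne t nu lam a * hlQOne t nu mu b else 0) := by
        refine tsum_congr fun nu => ?_
        by_cases h1 : decide (nu.colLen 0 = lam.colLen 0 + 1) = top
        · by_cases h2 : decide (nu.colLen 0 = mu.colLen 0) = right
          · rw [if_pos h1, if_pos h2, if_pos ⟨h1, h2⟩, ENNReal.ofReal_mul (hP _ _)]
          · simp [h2]
        · simp [h1]
    _ = ENNReal.ofReal ((1 - t * a * b) / (1 - a * b) * V) := by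
        rw [← hU.tsum_eq, ENNReal.ofReal_tsum_of_nonneg _ hU.summable]
        intro nu
        split_ifs
        · exact mul_nonneg (hP _ _) (hQ _ _)
        · exact le_rfl
    _ = _ := by
        rw [ENNReal.ofReal_mul hc, ← hV.tsum_eq, ENNReal.ofReal_tsum_of_nonneg _ hV.summable]
        · congr 1
          refine tsum_congr fun ka => ?_
          rw [ENNReal.ofReal_mul (hw _ _), ENNReal.ofReal_mul (hP _ _)]
        · exact fun ka => mul_nonneg (hw _ _) (mul_nonneg (hP _ _) (hQ _ _))

/-! ### Exchange of a row with a chain of partitions -/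

open Classical in
/-- The weight `∑ P_{λ¹}(a_1) P_{λ²/λ¹}(a_2) ⋯ P_{λᵐ/λᵐ⁻¹}(a_m)` over the sequences of partitions that
end at `λᵐ` and for which the list, latest step first, records whether the number of parts goes up
by one. -/
noncomputable def chainWeight (t : ℝ) (a : ℕ → ℝ) : List Bool → YoungDiagram → ℝ≥0∞
  | [], nu => if nu = ⊥ then 1 else 0
  | e :: v, nu => ∑' lam : YoungDiagram, chainWeight t a v lam *
      if decide (nu.colLen 0 = lam.colLen 0 + 1) = e then
        ENNReal.ofReal (hlPOne t nu lam (a (v.length + 1))) else 0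

/-- The weight of a row of the six vertex model, with spectral parameters `s 0, s 1, …`, one path
entering from the left, the given vertical edges below and above (listed from right to left) and
the given last horizontal edge. -/
noncomputable def rowWeight (t : ℝ) (s : ℕ → ℝ) : List Bool → List Bool → Bool → ℝ≥0∞
  | [], [], j => if j = true then 1 else 0
  | i :: v, e :: v', j => ∑' j' : Bool, rowWeight t s v v' j' *
      ENNReal.ofReal (vertexWeight t (s v.length) (j', i) (j, e))
  | [], _ :: _, _ => 0
  | _ :: _, [], _ => 0

theorem length_eq_of_rowWeight_ne_zero {t : ℝ} {s : ℕ → ℝ} {v v' : List Bool} {j : Bool}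
    (h : rowWeight t s v v' j ≠ 0) : v.length = v'.length := by
  induction v generalizing v' j with
  | nil => cases v' with
    | nil => rfl
    | cons => simp [rowWeight] at h
  | cons i v ih => cases v' with
    | nil => simp [rowWeight] at h
    | cons e v' =>
      simp only [rowWeight, ne_eq, ENNReal.tsum_eq_zero, not_forall] at h
      obtain ⟨j', hj'⟩ := h
      simp [ih (left_ne_zero_of_mul hj')]

theorem tsum_list_eq_tsum_cons {α : Type*} {f : List α → ℝ≥0∞} (hf : f [] = 0) :
    ∑' v, f v = ∑' i, ∑' v, f (i :: v) := by
  have hinj : Function.Injective fun p : α × List α => p.1 :: p.2 := by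
    rintro ⟨i, v⟩ ⟨i', v'⟩ h
    simpa using h
  rw [← ENNReal.tsum_prod (f := fun i v => f (i :: v)), ← hinj.tsum_eq (f := f)]
  rintro (_ | ⟨i, v⟩) hv
  · exact absurd hf hv
  · exact ⟨(i, v), rfl⟩

theorem tsum_bool_ite (x : Bool) (f : Bool → ℝ≥0∞) :
    ∑' i, (if x = i then f i else 0) = f x := by
  rw [tsum_eq_single x fun i hi => if_neg fun h => hi h.symm, if_pos rfl]

/-- One row of the six vertex model intertwines the chain weights: exchange of the operators
`∑_λ P_{λ/κ}(a_i)` with `Q_{λ/μ}(b)`. -/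
theorem tsum_chainWeight_mul_hlQOne {t b : ℝ} {a s : ℕ → ℝ} (ht : 0 < t) (ht1 : t < 1)
    (ha : ∀ x, 0 ≤ a (x + 1)) (hb : 0 ≤ b) (hz1 : ∀ x, a (x + 1) * b < 1)
    (hs : ∀ x, a (x + 1) * b * (√t * s x) = 1) (hw : ∀ x i o, 0 ≤ vertexWeight t (s x) i o)
    (v' : List Bool) (j : Bool) (mu : YoungDiagram) :
    (∑' lam : YoungDiagram, chainWeight t a v' lam *
      if decide (lam.colLen 0 = mu.colLen 0) = j then ENNReal.ofReal (hlQOne t lam mu b) else 0) =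
    (∏ i ∈ Finset.Icc 1 v'.length, ENNReal.ofReal ((1 - t * a i * b) / (1 - a i * b))) *
      ∑' v, rowWeight t s v v' j * chainWeight t a v mu := by
  induction v' generalizing j mu with
  | nil =>
    rw [tsum_eq_single ⊥ fun lam h => by simp [chainWeight, h],
      tsum_eq_single [] fun v h => by cases v <;> simp_all [rowWeight]]
    -- The chain starts at `∅` for every `N`, so no part is ever added at level `0`. This
    -- corresponds to the path that enters every row from the left.
    by_cases hmu : mu = ⊥
    · subst hmu
      rw [hlQOne_self_bot]
      cases j <;> simp [chainWeight, rowWeight]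
    · have : hlQOne t ⊥ mu b = 0 := by
        by_contra h
        exact hmu (le_bot_iff.1 (interlaces_of_hlQOne_ne_zero h).le)
      simp [chainWeight, hmu, this]
  | cons e v' ih =>
    set C := ∏ i ∈ Finset.Icc 1 v'.length, ENNReal.ofReal ((1 - t * a i * b) / (1 - a i * b))
      with hC
    set n := v'.length with hn
    set c := ENNReal.ofReal ((1 - t * a (n + 1) * b) / (1 - a (n + 1) * b)) with hc
    set w : Bool → Bool → ℝ≥0∞ := fun j' i =>
      ENNReal.ofReal (vertexWeight t (s n) (j', i) (j, e)) with hw'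
    set P : Bool → YoungDiagram → ℝ≥0∞ := fun i ka =>
      if decide (mu.colLen 0 = ka.colLen 0 + 1) = i then ENNReal.ofReal (hlPOne t mu ka (a (n + 1)))
        else 0 with hP
    -- The incoming edges are determined by `λ`, `κ`, `μ`. Summing over all their possible values
    -- separates the vertex weight from the partitions.
    have key : ∀ lam ka : YoungDiagram,
        ENNReal.ofReal (vertexWeight t (s n) (decide (lam.colLen 0 = ka.colLen 0),
          decide (mu.colLen 0 = ka.colLen 0 + 1)) (j, e)) *
          (ENNReal.ofReal (hlPOne t mu ka (a (n + 1))) * ENNReal.ofReal (hlQOne t lam ka b)) =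
        ∑' i, ∑' j', w j' i * P i ka * if decide (lam.colLen 0 = ka.colLen 0) = j' then
          ENNReal.ofReal (hlQOne t lam ka b) else 0 := by
      intro lam ka
      simp only [hP, mul_ite, ite_mul, mul_zero, zero_mul]
      simp only [tsum_bool_ite]
      simp only [hw', mul_assoc]
    -- The sum over the last partition `ν` is carried out first, by the local identity at the last
    -- column. It leaves `Q_{λ/κ}(b)` acting on the shorter chain that ends at `λ`, to which the
    -- induction hypothesis applies with `κ` in place of `μ`.
    have hlhs : (∑' nu : YoungDiagram, chainWeight t a (e :: v') nu *
        if decide (nu.colLen 0 = mu.colLen 0) = j then ENNReal.ofReal (hlQOne t nu mu b) else 0) =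
        c * ∑' i, ∑' j', ∑' ka, w j' i * P i ka * (C * ∑' v, rowWeight t s v v' j' *
          chainWeight t a v ka) := by
      calc _ = ∑' lam, chainWeight t a v' lam * ∑' nu : YoungDiagram,
            (if decide (nu.colLen 0 = lam.colLen 0 + 1) = e then
              ENNReal.ofReal (hlPOne t nu lam (a (n + 1))) else 0) *
            if decide (nu.colLen 0 = mu.colLen 0) = j then ENNReal.ofReal (hlQOne t nu mu b)
              else 0 := by
            simp only [chainWeight, ← ENNReal.tsum_mul_right, ← ENNReal.tsum_mul_left]
            rw [ENNReal.tsum_comm]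
            simp only [mul_assoc, hn]
        _ = ∑' lam, chainWeight t a v' lam * (c * ∑' ka, ∑' i, ∑' j', w j' i * P i ka *
              if decide (lam.colLen 0 = ka.colLen 0) = j' then
                ENNReal.ofReal (hlQOne t lam ka b) else 0) := by
            refine tsum_congr fun lam => ?_
            rw [tsum_vertexWeight ht ht1 (ha n) hb (hz1 n) (hs n) (hw n)]
            simp only [key, hc]
        _ = c * ∑' lam, ∑' ka, ∑' i, ∑' j', w j' i * P i ka * (chainWeight t a v' lam *
              if decide (lam.colLen 0 = ka.colLen 0) = j' then
                ENNReal.ofReal (hlQOne t lam ka b) else 0) := by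
            simp only [← ENNReal.tsum_mul_left]
            refine tsum_congr fun lam => tsum_congr fun ka => tsum_congr fun i =>
              tsum_congr fun j' => by ring
        _ = c * ∑' i, ∑' j', ∑' ka, ∑' lam, w j' i * P i ka * (chainWeight t a v' lam *
              if decide (lam.colLen 0 = ka.colLen 0) = j' then
                ENNReal.ofReal (hlQOne t lam ka b) else 0) := by
            congr 1
            rw [ENNReal.tsum_comm]
            simp only [ENNReal.tsum_comm (α := YoungDiagram) (β := Bool)]
        _ = _ := by
            simp only [ENNReal.tsum_mul_left, ih]
    rw [hlhs, List.length_cons, Finset.prod_Icc_succ_top (by omega), ← hC, ← hn, ← hc,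
      tsum_list_eq_tsum_cons (by simp [rowWeight]), mul_comm C c, mul_assoc]
    congr 1
    rw [← ENNReal.tsum_mul_left]
    refine tsum_congr fun i => ?_
    have hterm : ∀ v, rowWeight t s (i :: v) (e :: v') j * chainWeight t a (i :: v) mu =
        ∑' j', ∑' ka, rowWeight t s v v' j' * w j' i * (chainWeight t a v ka * P i ka) := by
      intro v
      simp only [rowWeight, chainWeight, ← ENNReal.tsum_mul_left, ← ENNReal.tsum_mul_right]
      rw [ENNReal.tsum_comm]
      refine tsum_congr fun j' => tsum_congr fun ka => ?_
      -- The parameters are indexed by the length of `v` on one side and of `v'` on the other. A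
      -- nonzero row weight forces these lengths to agree.
      by_cases h0 : rowWeight t s v v' j' = 0
      · simp [h0]
      · have hlen := length_eq_of_rowWeight_ne_zero h0
        simp only [hw', hP, hlen, hn]
    simp only [hterm]
    conv_rhs => rw [ENNReal.tsum_comm, ← ENNReal.tsum_mul_left]
    refine tsum_congr fun j' => ?_
    conv_rhs => rw [ENNReal.tsum_comm, ← ENNReal.tsum_mul_left]
    refine tsum_congr fun ka => ?_
    simp only [← ENNReal.tsum_mul_left]
    exact tsum_congr fun v => by ring

theorem hlQ_nonneg {t : ℝ} (h0 : 0 ≤ t) (h1 : t ≤ 1) {b : ℕ → ℝ} (hb : ∀ n, 0 ≤ b (n + 1)) (n : ℕ)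
    (lam : YoungDiagram) : 0 ≤ hlQ t b n lam := by
  induction n generalizing lam with
  | zero => rw [hlQ]; split_ifs <;> norm_num
  | succ n ih =>
    rw [hlQ]
    exact finsum_nonneg fun mu => mul_nonneg (ih mu) (hlQOne_nonneg h0 h1 _ _ (hb n))

/-- Only the finitely many `μ ⊂ λ` contribute, so the `finsum` in the branching rule has finite
support and agrees with the `tsum`. -/
theorem ofReal_hlQ_succ {t : ℝ} (h0 : 0 ≤ t) (h1 : t ≤ 1) {b : ℕ → ℝ} (hb : ∀ n, 0 ≤ b (n + 1))
    (n : ℕ) (lam : YoungDiagram) :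
    ENNReal.ofReal (hlQ t b (n + 1) lam) = ∑' mu : YoungDiagram,
      ENNReal.ofReal (hlQ t b n mu) * ENNReal.ofReal (hlQOne t lam mu (b (n + 1))) := by
  have hfin : (Function.support fun mu => hlQ t b n mu * hlQOne t lam mu (b (n + 1))).Finite :=
    (finite_le lam).subset fun mu hmu =>
      (interlaces_of_hlQOne_ne_zero (right_ne_zero_of_mul hmu)).le
  rw [hlQ, ← tsum_eq_finsum (L := .unconditional _) hfin, ENNReal.ofReal_tsum_of_nonneg]
  · simp only [ENNReal.ofReal_mul (hlQ_nonneg h0 h1 hb _ _)]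
  · exact fun mu => mul_nonneg (hlQ_nonneg h0 h1 hb _ _) (hlQOne_nonneg h0 h1 _ _ (hb n))
  · exact summable_of_hasFiniteSupport hfin

/-- A chain that ends at `∅` is constantly `∅`. This matches the empty lower boundary of the
quadrant, the case `N = 0`. -/
theorem chainWeight_bot (t : ℝ) (a : ℕ → ℝ) (v : List Bool) :
    chainWeight t a v ⊥ = if true ∈ v then 0 else 1 := by
  induction v with
  | nil => simp [chainWeight]
  | cons e v ih =>
    rw [chainWeight, tsum_eq_single ⊥]
    · rw [ih, hlPOne_self_bot]
      cases e <;> simp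
    · intro lam hlam
      have : hlPOne t ⊥ lam (a (v.length + 1)) = 0 := by
        by_contra h
        exact hlam (le_bot_iff.1 (interlaces_of_hlPOne_ne_zero h).le)
      simp [this]

/-- The recursion in `N` of the unnormalized law of the increments of the numbers of parts. -/
theorem tsum_chainWeight_mul_hlQ_succ {t : ℝ} {a b s : ℕ → ℝ} {n : ℕ} (ht : 0 < t) (ht1 : t < 1)
    (ha : ∀ x, 0 ≤ a (x + 1)) (hb : ∀ n, 0 ≤ b (n + 1)) (hz1 : ∀ x, a (x + 1) * b (n + 1) < 1)
    (hs : ∀ x, a (x + 1) * b (n + 1) * (√t * s x) = 1)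
    (hw : ∀ x i o, 0 ≤ vertexWeight t (s x) i o) (v' : List Bool) :
    ∑' lam, chainWeight t a v' lam * ENNReal.ofReal (hlQ t b (n + 1) lam) =
    (∏ i ∈ Finset.Icc 1 v'.length,
        ENNReal.ofReal ((1 - t * a i * b (n + 1)) / (1 - a i * b (n + 1)))) *
      ∑' v, (∑' lam, chainWeight t a v lam * ENNReal.ofReal (hlQ t b n lam)) *
        ∑' j, rowWeight t s v v' j := by
  set C := ∏ i ∈ Finset.Icc 1 v'.length,
        ENNReal.ofReal ((1 - t * a i * b (n + 1)) / (1 - a i * b (n + 1))) with hC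
  -- Summing over `j` inserts the last horizontal edge of the row, which is not recorded in the law
  -- of the vertical edges.
  have hbool : ∀ lam mu : YoungDiagram, ENNReal.ofReal (hlQOne t lam mu (b (n + 1))) =
      ∑' j, if decide (lam.colLen 0 = mu.colLen 0) = j then
        ENNReal.ofReal (hlQOne t lam mu (b (n + 1))) else 0 :=
    fun lam mu => (tsum_bool_ite _ fun _ => _).symm
  calc _ = ∑' mu, ∑' j, ENNReal.ofReal (hlQ t b n mu) *
        ∑' lam, chainWeight t a v' lam * if decide (lam.colLen 0 = mu.colLen 0) = j then
        ENNReal.ofReal (hlQOne t lam mu (b (n + 1))) else 0 := by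
        simp only [ofReal_hlQ_succ ht.le ht1.le hb]
        simp only [← ENNReal.tsum_mul_left]
        rw [ENNReal.tsum_comm]
        refine tsum_congr fun mu => ?_
        rw [ENNReal.tsum_comm]
        refine tsum_congr fun lam => ?_
        conv_lhs => rw [hbool lam mu, ← ENNReal.tsum_mul_left, ← ENNReal.tsum_mul_left]
        exact tsum_congr fun j => by ring
    _ = ∑' mu, ∑' j, ENNReal.ofReal (hlQ t b n mu) *
        (C * ∑' v, rowWeight t s v v' j * chainWeight t a v mu) := by
        simp only [tsum_chainWeight_mul_hlQOne ht ht1 ha (hb n) hz1 hs hw, ← hC]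
    _ = _ := by
        simp only [← ENNReal.tsum_mul_left, ← ENNReal.tsum_mul_right]
        rw [tsum_congr fun mu => ENNReal.tsum_comm, ENNReal.tsum_comm]
        refine tsum_congr fun v => ?_
        rw [ENNReal.tsum_comm]
        exact tsum_congr fun j => tsum_congr fun mu => by ring

/-! ### Increments of the numbers of parts in the Hall–Littlewood process -/

/-- The list `[f (n - 1), …, f 0]`. -/
def bitList (f : ℕ → Bool) : ℕ → List Bool
  | 0 => []
  | n + 1 => f n :: bitList f n

@[simp]
theorem length_bitList (f : ℕ → Bool) (n : ℕ) : (bitList f n).length = n := by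
  induction n with
  | zero => rfl
  | succ n ih => simp [bitList, ih]

theorem bitList_congr {f g : ℕ → Bool} {n : ℕ} (h : ∀ k < n, f k = g k) :
    bitList f n = bitList g n := by
  induction n with
  | zero => rfl
  | succ n ih => rw [bitList, bitList, h n (by omega), ih fun k hk => h k (by omega)]

/-- The latest bit stands first, so dropping recovers the bits of the first `m` columns. All levels
`m_i ≤ M` can thus be read off one list of length `M`. -/
theorem drop_bitList (f : ℕ → Bool) {m n : ℕ} (h : m ≤ n) :
    (bitList f n).drop (n - m) = bitList f m := by
  induction n with
  | zero => obtain rfl : m = 0 := by omega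
            rfl
  | succ n ih =>
    rcases Nat.lt_or_ge n m with h1 | h1
    · obtain rfl : m = n + 1 := by omega
      simp
    · rw [Nat.succ_sub h1, bitList, List.drop_succ_cons, ih h1]

/-- Whether the number of parts goes up by one in the step from `L n` to `L (n + 1)`. -/
def lengthStep (L : ℕ → YoungDiagram) (n : ℕ) : Bool :=
  decide ((L (n + 1)).colLen 0 = (L n).colLen 0 + 1)

theorem hlLevel_snoc_of_le {M : ℕ} (lam : Fin M → YoungDiagram) (nu : YoungDiagram) {m : ℕ}
    (hm : m ≤ M) :
    hlLevel (Fin.snoc (α := fun _ => YoungDiagram) lam nu) m = hlLevel lam m := by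
  cases m with
  | zero => rfl
  | succ m =>
    rw [hlLevel, hlLevel, dif_pos (by omega), dif_pos (by omega)]
    exact Fin.snoc_castSucc (α := fun _ => YoungDiagram) nu lam ⟨m, by omega⟩

theorem hlLevel_snoc_last {M : ℕ} (lam : Fin M → YoungDiagram) (nu : YoungDiagram) :
    hlLevel (Fin.snoc (α := fun _ => YoungDiagram) lam nu) (M + 1) = nu := by
  rw [hlLevel, dif_pos (by omega)]
  exact Fin.snoc_last (α := fun _ => YoungDiagram) nu lam

theorem tsum_hlLevel_eq_tsum_chainWeight (t : ℝ) (a : ℕ → ℝ) (M : ℕ) (v : List Bool)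
    (hv : v.length = M) (F : YoungDiagram → ℝ≥0∞) :
    (∑' lam : Fin M → YoungDiagram, if bitList (lengthStep (hlLevel lam)) M = v then
      (∏ i ∈ Finset.Icc 1 M, ENNReal.ofReal (hlPOne t (hlLevel lam i) (hlLevel lam (i - 1)) (a i))) *
        F (hlLevel lam M) else 0) =
    ∑' nu, chainWeight t a v nu * F nu := by
  induction M generalizing v F with
  | zero =>
    obtain rfl := List.length_eq_zero_iff.1 hv
    rw [tsum_eq_single default fun lam h => absurd (Subsingleton.elim _ _) h,
      tsum_eq_single ⊥ fun lam h => by simp [chainWeight, h]]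
    simp [bitList, chainWeight, hlLevel]
  | succ M ih =>
    obtain ⟨e, v, rfl⟩ := List.exists_cons_of_length_eq_add_one hv
    have hv' : v.length = M := by simpa using hv
    rw [← (Fin.snocEquiv fun _ : Fin (M + 1) => YoungDiagram).tsum_eq, ENNReal.tsum_prod']
    refine tsum_congr fun nu => ?_
    rw [chainWeight, hv', ← ih v hv', ← ENNReal.tsum_mul_right]
    refine tsum_congr fun lam => ?_
    have h1 : ∀ m ≤ M, hlLevel ((Fin.snocEquiv fun _ : Fin (M + 1) => YoungDiagram) (nu, lam)) m =
        hlLevel lam m := fun m hm => hlLevel_snoc_of_le lam nu hm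
    have h2 : hlLevel ((Fin.snocEquiv fun _ : Fin (M + 1) => YoungDiagram) (nu, lam)) (M + 1) = nu :=
      hlLevel_snoc_last lam nu
    have h3 : bitList (lengthStep (hlLevel
        ((Fin.snocEquiv fun _ : Fin (M + 1) => YoungDiagram) (nu, lam)))) M =
        bitList (lengthStep (hlLevel lam)) M :=
      bitList_congr fun k hk => by rw [lengthStep, lengthStep, h1 _ (by omega), h1 _ (by omega)]
    have h4 : ∀ i ∈ Finset.Icc 1 M, ENNReal.ofReal (hlPOne t
        (hlLevel ((Fin.snocEquiv fun _ : Fin (M + 1) => YoungDiagram) (nu, lam)) i)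
        (hlLevel ((Fin.snocEquiv fun _ : Fin (M + 1) => YoungDiagram) (nu, lam)) (i - 1)) (a i)) =
        ENNReal.ofReal (hlPOne t (hlLevel lam i) (hlLevel lam (i - 1)) (a i)) := fun i hi => by
      have := Finset.mem_Icc.1 hi
      rw [h1 _ (by omega), h1 _ (by omega)]
    simp only [bitList, h3, List.cons.injEq]
    rw [Finset.prod_Icc_succ_top (by omega), Finset.prod_congr rfl h4,
      h2, Nat.add_sub_cancel, h1 M le_rfl]
    simp only [lengthStep, h2, h1 M le_rfl]
    by_cases c1 : decide (nu.colLen 0 = (hlLevel lam M).colLen 0 + 1) = e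
    · by_cases c2 : bitList (lengthStep (hlLevel lam)) M = v
      · rw [if_pos ⟨c1, c2⟩, if_pos c2, if_pos c1]
      · rw [if_neg fun h => c2 h.2, if_neg c2, zero_mul]
    · rw [if_neg fun h => c1 h.1, if_neg c1]
      simp

theorem colLen_hlLevel_eq_count {M : ℕ} {lam : Fin M → YoungDiagram}
    (h : ∀ i, i < M → Interlaces (hlLevel lam i) (hlLevel lam (i + 1))) {m : ℕ} (hm : m ≤ M) :
    (hlLevel lam m).colLen 0 = (bitList (lengthStep (hlLevel lam)) m).count true := by
  induction m with
  | zero => simp [hlLevel, bitList]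
  | succ m ih =>
    have h1 := interlaces_iff_colLen.1 (h m (by omega)) 0
    rw [bitList, List.count_cons, ← ih (by omega), lengthStep]
    by_cases h2 : (hlLevel lam (m + 1)).colLen 0 = (hlLevel lam m).colLen 0 + 1
    · simp [h2]
    · simp [h2]; omega

theorem hlProcess_apply {t : ℝ} {a b : ℕ → ℝ} {M N : ℕ} (S : Set (Fin M → YoungDiagram))
    [DecidablePred (· ∈ S)] :
    hlProcess t a b M N S = ∑' lam, if lam ∈ S then ENNReal.ofReal (hlProb t a b M N lam) else 0 := by
  rw [hlProcess, Measure.sum_apply _ S.to_countable.measurableSet]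
  refine tsum_congr fun lam => ?_
  rw [Measure.smul_apply, Measure.dirac_apply' _ S.to_countable.measurableSet]
  by_cases h : lam ∈ S <;> simp [h]

theorem hlProcess_bitList {t : ℝ} {a b : ℕ → ℝ} {M N : ℕ} (ht : 0 < t) (ht1 : t < 1)
    (ha : ∀ x, 0 ≤ a (x + 1)) (hb : ∀ n, 0 ≤ b (n + 1)) (hz1 : ∀ x n, a (x + 1) * b (n + 1) < 1)
    (v : List Bool) (hv : v.length = M) :
    hlProcess t a b M N {lam | bitList (lengthStep (hlLevel lam)) M = v} =
      (∑' nu, chainWeight t a v nu * ENNReal.ofReal (hlQ t b N nu)) /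
      ∏ j ∈ Finset.Icc 1 N, ∏ i ∈ Finset.Icc 1 M,
        ENNReal.ofReal ((1 - t * a i * b j) / (1 - a i * b j)) := by
  classical
  have hpos : ∀ i ∈ Finset.Icc 1 M, ∀ j ∈ Finset.Icc 1 N,
      0 < (1 - t * a i * b j) / (1 - a i * b j) := by
    intro i hi j hj
    obtain ⟨x, rfl⟩ : ∃ x, i = x + 1 := ⟨i - 1, by have := Finset.mem_Icc.1 hi; omega⟩
    obtain ⟨n, rfl⟩ : ∃ n, j = n + 1 := ⟨j - 1, by have := Finset.mem_Icc.1 hj; omega⟩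
    have h1 := hz1 x n
    have h2 := mul_nonneg (ha x) (hb n)
    refine div_pos ?_ (by linarith)
    nlinarith
  rw [hlProcess_apply, ← tsum_hlLevel_eq_tsum_chainWeight t a M v hv, div_eq_mul_inv,
    ← ENNReal.tsum_mul_right]
  refine tsum_congr fun lam => ?_
  simp only [Set.mem_ofPred_eq, ite_mul, zero_mul]
  refine if_congr Iff.rfl ?_ rfl
  have hP : ∀ i ∈ Finset.Icc 1 M, 0 ≤ hlPOne t (hlLevel lam i) (hlLevel lam (i - 1)) (a i) := by
    intro i hi
    obtain ⟨x, rfl⟩ : ∃ x, i = x + 1 := ⟨i - 1, by have := Finset.mem_Icc.1 hi; omega⟩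
    exact hlPOne_nonneg ht.le ht1.le _ _ (ha x)
  rw [hlProb, ENNReal.ofReal_div_of_pos, ENNReal.ofReal_mul (Finset.prod_nonneg hP),
    ENNReal.ofReal_prod_of_nonneg hP, ENNReal.ofReal_prod_of_nonneg, div_eq_mul_inv]
  · congr 2
    refine Finset.prod_congr rfl fun j hj => ?_
    rw [ENNReal.ofReal_prod_of_nonneg fun i hi => (hpos i hi j hj).le]
  · exact fun j hj => Finset.prod_nonneg fun i hi => (hpos i hi j hj).le
  · exact Finset.prod_pos fun j hj => Finset.prod_pos fun i hi => hpos i hi j hj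

/-- Sequences of nonzero weight interlace, so `ℓ` grows by `0` or `1` at each step and is the number
of upward steps. For other sequences the bits need not determine `ℓ`, hence the restriction to
almost every sequence. -/
theorem ae_hlProcess_colLen (t : ℝ) (a b : ℕ → ℝ) (M N : ℕ) :
    ∀ᵐ lam ∂(hlProcess t a b M N), ∀ m ≤ M,
      (hlLevel lam m).colLen 0 = ((bitList (lengthStep (hlLevel lam)) M).drop (M - m)).count true := by
  classical
  rw [ae_iff, hlProcess_apply, ENNReal.tsum_eq_zero]
  intro lam
  rw [ite_eq_right_iff]
  intro hlam
  have : hlProb t a b M N lam = 0 := by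
    by_contra hne
    refine hlam fun m hm => ?_
    rw [drop_bitList _ hm]
    refine colLen_hlLevel_eq_count (fun i hi => ?_) hm
    rw [hlProb, div_eq_mul_inv] at hne
    have h1 := Finset.prod_ne_zero_iff.1 (left_ne_zero_of_mul (left_ne_zero_of_mul hne)) (i + 1)
      (Finset.mem_Icc.2 ⟨by omega, by omega⟩)
    exact interlaces_of_hlPOne_ne_zero h1
  rw [this, ENNReal.ofReal_zero]

/-! ### Independence of the responses and the law of a row -/

section Rule

variable {Q : ℝ} {xi u : ℕ → ℝ}

theorem ruleMeasure_coord (h : SixVertexParams Q xi u) (v : ℕ × ℕ) (i o : Bool × Bool) :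
    ruleMeasure h {ω | ω v i = o} =
      ENNReal.ofReal (vertexWeight Q (xi (v.1 + 1) * u (v.2 + 1)) i o) := by
  have h0 : Measurable fun f : Bool × Bool → Bool × Bool => f i := measurable_pi_apply i
  have h1 : MeasurableSet {f : Bool × Bool → Bool × Bool | f i = o} :=
    h0 (measurableSet_singleton o)
  have h2 := (measurePreserving_eval_infinitePi
    (fun v => Measure.pi fun i => (vertexLaw h v i).toMeasure) v).measure_preimage
      h1.nullMeasurableSet
  have h3 := (measurePreserving_eval (fun i => (vertexLaw h v i).toMeasure) i).measure_preimage
    (measurableSet_singleton o).nullMeasurableSet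
  refine (h2.trans h3).trans ?_
  rw [PMF.toMeasure_apply_singleton _ _ (measurableSet_singleton _)]
  rfl

theorem ruleMeasure_inter_coord (h : SixVertexParams Q xi u) {S : Finset (ℕ × ℕ)} {v : ℕ × ℕ}
    (hv : v ∉ S) {A : Set VertexRule} (hA : MeasurableSet A) (hS : DependsOn (· ∈ A) (S : Set (ℕ × ℕ)))
    (i o : Bool × Bool) :
    ruleMeasure h (A ∩ {ω | ω v i = o}) = ruleMeasure h A *
      ENNReal.ofReal (vertexWeight Q (xi (v.1 + 1) * u (v.2 + 1)) i o) := by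
  rw [← ruleMeasure_coord h v i o]
  have hind : iIndepFun (fun v (ω : VertexRule) => ω v) (ruleMeasure h) :=
    iIndepFun_infinitePi (P := fun v => Measure.pi fun i => (vertexLaw h v i).toMeasure)
      (X := fun _ f => f) fun _ => measurable_id
  have hind2 := hind.indepFun_finset S {v} (Finset.disjoint_singleton_right.2 hv)
    fun v => measurable_pi_apply v
  -- Any extension off `S` serves, here the identity response. Since `A` depends on `S` only, it is
  -- the preimage of `ext ⁻¹' A` under restriction to `S`, and independence of disjoint families of
  -- coordinates applies.
  let ext : (S → Bool × Bool → Bool × Bool) → VertexRule := fun z v =>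
    if hv : v ∈ S then z ⟨v, hv⟩ else fun i => i
  have hext : Measurable ext := by
    refine measurable_pi_lambda _ fun v => ?_
    by_cases hv : v ∈ S
    · simp only [ext, hv, dif_pos]; exact measurable_pi_apply _
    · simp only [ext, hv]; exact measurable_const
  have e1 : A = (fun (ω : VertexRule) (v : S) => ω v) ⁻¹' (ext ⁻¹' A) := by
    ext ω
    refine iff_of_eq (hS fun v hv => ?_)
    simp only [ext, dif_pos (Finset.mem_coe.1 hv)]
  have e2 : {ω : VertexRule | ω v i = o} =
      (fun (ω : VertexRule) (v' : ({v} : Finset (ℕ × ℕ))) => ω v') ⁻¹'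
        {z | z ⟨v, Finset.mem_singleton_self v⟩ i = o} := rfl
  rw [e2]
  conv_lhs => rw [e1]
  conv_rhs => rw [e1]
  refine hind2.measure_inter_preimage_eq_mul _ _ (hext hA) ?_
  have : Measurable fun z : (({v} : Finset (ℕ × ℕ)) → Bool × Bool → Bool × Bool) =>
      z ⟨v, Finset.mem_singleton_self v⟩ i :=
    (measurable_pi_apply i).comp (measurable_pi_apply _)
  exact this (measurableSet_singleton o)

end Rule

/-- The state at `(x, y)` only depends on the responses at the vertices weakly below and to the left
of it. -/
theorem grow_congr {ω ω' : VertexRule} {x y : ℕ} (h : ∀ x' < x, ∀ y' < y, ω (x', y') = ω' (x', y')) :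
    grow ω x y = grow ω' x y := by
  induction hn : x + y using Nat.strong_induction_on generalizing x y with
  | _ n ih =>
    rcases x with _ | x <;> rcases y with _ | y
    · simp only [grow]
    · simp only [grow]
    · simp only [grow]
    · have h1 : grow ω x (y + 1) = grow ω' x (y + 1) :=
        ih _ (by omega) (fun x' hx y' hy => h x' (by omega) y' hy) rfl
      have h2 : grow ω (x + 1) y = grow ω' (x + 1) y :=
        ih _ (by omega) (fun x' hx y' hy => h x' hx y' (by omega)) rfl
      rw [grow, grow, h1, h2, h x (by omega) y (by omega)]

/-- Whether the vertical edge from `(x + 1, y)` to `(x + 1, y + 1)` is occupied. -/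
def topBit (σ : EdgeConfig) (y x : ℕ) : Bool := (σ (x + 1) y).2

theorem topBit_grow_congr {ω ω' : VertexRule} {x y : ℕ}
    (h : ∀ x' ≤ x, ∀ y' < y, ω (x', y') = ω' (x', y')) :
    topBit (grow ω) y x = topBit (grow ω') y x := by
  rw [topBit, topBit, grow_congr fun x' hx y' hy => h x' (by omega) y' hy]

theorem measurableSet_bitList {α : Type*} [MeasurableSpace α] {f : α → ℕ → Bool}
    (hf : ∀ n, Measurable fun x => f x n) (n : ℕ) (v : List Bool) :
    MeasurableSet {x | bitList (f x) n = v} := by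
  induction n generalizing v with
  | zero => simp only [bitList, MeasurableSet.const]
  | succ n ih =>
    cases v with
    | nil => simp [bitList]
    | cons e v =>
      simp only [bitList, List.cons.injEq]
      exact (hf n (measurableSet_singleton e)).inter (ih v)

theorem measurable_topBit (y x : ℕ) : Measurable fun σ : EdgeConfig => topBit σ y x := by
  unfold topBit
  fun_prop

theorem measurable_topBit_grow (y x : ℕ) : Measurable fun ω : VertexRule => topBit (grow ω) y x :=
  (measurable_topBit y x).comp measurable_grow

theorem measure_eq_tsum_inter_fiber {α ι : Type*} [MeasurableSpace α] [Countable ι] (μ : Measure α)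
    {E : Set α} (hE : MeasurableSet E) {g : α → ι} (hg : ∀ i, MeasurableSet {x | g x = i}) :
    μ E = ∑' i, μ (E ∩ {x | g x = i}) := by
  rw [← measure_iUnion]
  · congr 1
    ext x
    simp
  · intro i j hij
    refine Set.disjoint_left.2 fun x hx hx' => hij ?_
    exact hx.2.symm.trans hx'.2
  · exact fun i => hE.inter (hg i)

section Row

variable {Q : ℝ} {xi u : ℕ → ℝ}

/-- The joint law of the lowest `k` vertical edges above the row `n + 1` and the last horizontal edge
of this row, given an event that depends on the rows up to `n`. -/
theorem ruleMeasure_row (h : SixVertexParams Q xi u) (n k : ℕ) (v v' : List Bool) (j : Bool)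
    (hv : v.length = k) {A : Set VertexRule} (hA : MeasurableSet A) {K : ℕ}
    (hK : DependsOn (· ∈ A) (Finset.range K ×ˢ Finset.range n : Finset (ℕ × ℕ))) :
    ruleMeasure h ({ω | ω ∈ A ∧ bitList (topBit (grow ω) n) k = v ∧
      bitList (topBit (grow ω) (n + 1)) k = v' ∧ (grow ω k (n + 1)).1 = j}) =
    ruleMeasure h {ω | ω ∈ A ∧ bitList (topBit (grow ω) n) k = v} *
      rowWeight Q (fun x => xi (x + 1) * u (n + 1)) v v' j := by
  induction k generalizing v v' j A K with
  | zero =>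
    obtain rfl := List.length_eq_zero_iff.1 hv
    rcases v' with _ | ⟨e, v'⟩
    · cases j <;> simp [bitList, rowWeight, grow]
    · simp [bitList, rowWeight]
  | succ k ih =>
    obtain ⟨i, v, rfl⟩ := List.exists_cons_of_length_eq_add_one hv
    have hv1 : v.length = k := by simpa using hv
    rcases v' with _ | ⟨e, v'⟩
    · simp [bitList, rowWeight]
    -- The edge below the last vertex depends on lower rows only, so it is absorbed into the past
    -- event before the induction hypothesis is applied to the first `k` columns. This is why the
    -- statement allows an arbitrary event `A`.
    set A' : Set VertexRule := {ω | ω ∈ A ∧ topBit (grow ω) n k = i} with hA'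
    have mA' : MeasurableSet A' :=
      hA.inter (measurable_topBit_grow n k (measurableSet_singleton i))
    have dA' : DependsOn (· ∈ A')
        (Finset.range (max K (k + 1)) ×ˢ Finset.range n : Finset (ℕ × ℕ)) := by
      intro ω ω' hω
      have h1 : (ω ∈ A) = (ω' ∈ A) := hK fun v hv => hω v (by
        simp only [Finset.coe_product, Finset.coe_range, Set.mem_prod, Set.mem_Iio] at hv ⊢
        exact ⟨lt_max_of_lt_left hv.1, hv.2⟩)
      have h2 : topBit (grow ω) n k = topBit (grow ω') n k :=
        topBit_grow_congr fun x hx y hy => hω _ (by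
          simp only [Finset.coe_product, Finset.coe_range, Set.mem_prod, Set.mem_Iio]
          exact ⟨lt_max_of_lt_right (by omega), hy⟩)
      simp only [hA', Set.mem_ofPred_eq, h1, h2]
    have hedge : ∀ (x y : ℕ) (c : Bool), MeasurableSet {ω : VertexRule | (grow ω x y).1 = c} :=
      fun x y c => (measurable_grow_apply x y).fst (measurableSet_singleton c)
    have hbits : ∀ (m y : ℕ) (w : List Bool),
        MeasurableSet {ω : VertexRule | bitList (topBit (grow ω) y) m = w} :=
      fun m y w => measurableSet_bitList (measurable_topBit_grow y) m w
    set B : Bool → Set VertexRule := fun j' => {ω | ω ∈ A' ∧ bitList (topBit (grow ω) n) k = v ∧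
      bitList (topBit (grow ω) (n + 1)) k = v' ∧ (grow ω k (n + 1)).1 = j'} with hB
    have mB : ∀ j', MeasurableSet (B j') := fun j' =>
      mA'.inter ((hbits k n v).inter ((hbits k (n + 1) v').inter (hedge k (n + 1) j')))
    have dB : ∀ j', DependsOn (· ∈ B j') ((Finset.range (max K (k + 1)) ×ˢ Finset.range n ∪
        Finset.range k ×ˢ Finset.range (n + 1) : Finset (ℕ × ℕ)) : Set (ℕ × ℕ)) := by
      intro j' ω ω' hω
      have h1 : (ω ∈ A') = (ω' ∈ A') := dA' fun v hv => hω v (by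
        rw [Finset.coe_union]; exact Or.inl hv)
      have h0 : ∀ x < k, ∀ y < n + 1, ω (x, y) = ω' (x, y) := fun x hx y hy => hω _ (by
        rw [Finset.coe_union]
        right
        simp only [Finset.coe_product, Finset.coe_range, Set.mem_prod, Set.mem_Iio]
        exact ⟨hx, hy⟩)
      have h2 : bitList (topBit (grow ω) n) k = bitList (topBit (grow ω') n) k :=
        bitList_congr fun m hm => topBit_grow_congr fun x hx y hy => h0 x (by omega) y (by omega)
      have h3 : bitList (topBit (grow ω) (n + 1)) k = bitList (topBit (grow ω') (n + 1)) k :=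
        bitList_congr fun m hm => topBit_grow_congr fun x hx y hy => h0 x (by omega) y (by omega)
      have h4 : grow ω k (n + 1) = grow ω' k (n + 1) := grow_congr h0
      simp only [hB, Set.mem_ofPred_eq, h1, h2, h3, h4]
    -- The event `B j'` involves rows below `n`, and columns below `k` in row `n`. The response at
    -- `(k, n)` is therefore independent of it.
    have hnot : (k, n) ∉ (Finset.range (max K (k + 1)) ×ˢ Finset.range n ∪
        Finset.range k ×ˢ Finset.range (n + 1) : Finset (ℕ × ℕ)) := by simp
    have hE : MeasurableSet {ω : VertexRule | ω ∈ A ∧ bitList (topBit (grow ω) n) (k + 1) = i :: v ∧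
        bitList (topBit (grow ω) (n + 1)) (k + 1) = e :: v' ∧ (grow ω (k + 1) (n + 1)).1 = j} :=
      hA.inter ((hbits _ _ _).inter ((hbits _ _ _).inter (hedge _ _ _)))
    rw [measure_eq_tsum_inter_fiber _ hE (hedge k (n + 1)), rowWeight, ← ENNReal.tsum_mul_left]
    refine tsum_congr fun j' => ?_
    have hset : {ω : VertexRule | ω ∈ A ∧ bitList (topBit (grow ω) n) (k + 1) = i :: v ∧
        bitList (topBit (grow ω) (n + 1)) (k + 1) = e :: v' ∧ (grow ω (k + 1) (n + 1)).1 = j} ∩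
        {ω | (grow ω k (n + 1)).1 = j'} = B j' ∩ {ω | ω (k, n) (j', i) = (j, e)} := by
      ext ω
      simp only [hB, hA', bitList, List.cons.injEq, Set.mem_inter_iff, Set.mem_ofPred_eq]
      constructor
      · rintro ⟨⟨a1, ⟨a2, a3⟩, ⟨a4, a5⟩, a6⟩, a7⟩
        refine ⟨⟨⟨a1, a2⟩, a3, a5, a7⟩, ?_⟩
        simp only [topBit] at a2 a4
        rw [grow, a7, a2] at a4 a6
        exact Prod.ext a6 a4
      · rintro ⟨⟨⟨a1, a2⟩, a3, a5, a7⟩, a8⟩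
        have a9 : grow ω (k + 1) (n + 1) = (j, e) := by
          simp only [topBit] at a2
          rw [grow, a7, a2, a8]
        refine ⟨⟨a1, ⟨a2, a3⟩, ⟨?_, a5⟩, ?_⟩, a7⟩
        · rw [topBit, a9]
        · rw [a9]
    rw [hset, ruleMeasure_inter_coord h hnot (mB j') (dB j'), hB, ih v v' j' hv1 mA' dA', mul_assoc,
      hv1]
    congr 2
    ext ω
    simp only [hA', bitList, List.cons.injEq, Set.mem_ofPred_eq, and_assoc]

/-- The Markov property from row to row. Apart from the Cauchy factors, this is the recursion of
`tsum_chainWeight_mul_hlQ_succ`. -/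
theorem ruleMeasure_bitList_succ (h : SixVertexParams Q xi u) (n M : ℕ) (v' : List Bool) :
    ruleMeasure h {ω | bitList (topBit (grow ω) (n + 1)) M = v'} =
      ∑' v, ruleMeasure h {ω | bitList (topBit (grow ω) n) M = v} *
        ∑' j, rowWeight Q (fun x => xi (x + 1) * u (n + 1)) v v' j := by
  have hbits : ∀ (m y : ℕ) (w : List Bool),
      MeasurableSet {ω : VertexRule | bitList (topBit (grow ω) y) m = w} :=
    fun m y w => measurableSet_bitList (measurable_topBit_grow y) m w
  have hedge : ∀ c : Bool, MeasurableSet {ω : VertexRule | (grow ω M (n + 1)).1 = c} :=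
    fun c => (measurable_grow_apply M (n + 1)).fst (measurableSet_singleton c)
  rw [measure_eq_tsum_inter_fiber _ (hbits M (n + 1) v') (hbits M n)]
  refine tsum_congr fun v => ?_
  by_cases hv : v.length = M
  · rw [measure_eq_tsum_inter_fiber _ ((hbits M (n + 1) v').inter (hbits M n v)) hedge,
      ← ENNReal.tsum_mul_left]
    refine tsum_congr fun j => ?_
    have := ruleMeasure_row h n M v v' j hv (A := Set.univ) MeasurableSet.univ (K := 0)
      (fun _ _ _ => rfl)
    simp only [Set.mem_univ, true_and] at this
    rw [← this]
    congr 1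
    ext ω
    simp only [Set.mem_inter_iff, Set.mem_ofPred_eq]
    tauto
  · have hempty : {ω : VertexRule | bitList (topBit (grow ω) n) M = v} = ∅ := by
      ext ω
      simp only [Set.mem_ofPred_eq, Set.mem_empty_iff_false, iff_false]
      rintro rfl
      exact hv (length_bitList _ _)
    rw [hempty]
    simp

end Row

/-! ### Conservation of paths and the height function -/

section Conservation

variable {Q : ℝ} {xi u : ℕ → ℝ}

/-- Configurations violating conservation have weight zero, and there are only countably many
vertices and inputs. Individual responses may violate it, so the statement is an almost sure one. -/
theorem ae_ruleMeasure_conserve (h : SixVertexParams Q xi u) : ∀ᵐ ω ∂ruleMeasure h, ∀ v i,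
    (ω v i).1.toNat + (ω v i).2.toNat = i.1.toNat + i.2.toNat := by
  rw [ae_all_iff]
  intro v
  rw [ae_all_iff]
  intro i
  have : ∀ᵐ ω ∂ruleMeasure h, ∀ o : Bool × Bool,
      o.1.toNat + o.2.toNat ≠ i.1.toNat + i.2.toNat → ω v i ≠ o := by
    rw [ae_all_iff]
    intro o
    by_cases ho : o.1.toNat + o.2.toNat = i.1.toNat + i.2.toNat
    · exact Filter.Eventually.of_forall fun ω hne => absurd ho hne
    · have h0 : ∀ s, vertexWeight Q s i o = 0 := fun s => by
        obtain ⟨_ | _, _ | _⟩ := i <;> obtain ⟨_ | _, _ | _⟩ := o <;> simp_all [vertexWeight]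
      have h1 : ∀ᵐ ω ∂ruleMeasure h, ω v i ≠ o := by
        rw [ae_iff]
        simp only [ne_eq, not_not]
        rw [ruleMeasure_coord, h0, ENNReal.ofReal_zero]
      exact h1.mono fun ω hω _ => hω
  filter_upwards [this] with ω hω
  by_contra hne
  exact hω _ hne rfl

theorem grow_row_conserve {ω : VertexRule}
    (hω : ∀ v i, (ω v i).1.toNat + (ω v i).2.toNat = i.1.toNat + i.2.toNat) (n m : ℕ) :
    (grow ω m (n + 1)).1.toNat + (bitList (topBit (grow ω) (n + 1)) m).count true =
      1 + (bitList (topBit (grow ω) n) m).count true := by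
  induction m with
  | zero => simp [grow, bitList]
  | succ m ih =>
    have h1 := hω (m, n) ((grow ω m (n + 1)).1, (grow ω (m + 1) n).2)
    rw [bitList, bitList, List.count_cons, List.count_cons, topBit, topBit, grow]
    set o := ω (m, n) ((grow ω m (n + 1)).1, (grow ω (m + 1) n).2)
    have hb : ∀ c : Bool, (if (c == true) = true then 1 else 0) = c.toNat := by decide
    rw [hb, hb]
    dsimp only at h1
    omega

/-- Of the `n` paths entering in the first `n` rows, each leaves the block of `m` columns and `n`
rows either through its right side, where `h` counts it, or through its top. -/
theorem heightFn_grow_add {ω : VertexRule}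
    (hω : ∀ v i, (ω v i).1.toNat + (ω v i).2.toNat = i.1.toNat + i.2.toNat) (n m : ℕ) :
    heightFn (grow ω) (m + 1) n + (bitList (topBit (grow ω) n) m).count true = n := by
  induction n with
  | zero =>
    have : ∀ m, (bitList (topBit (grow ω) 0) m).count true = 0 := by
      intro m
      induction m with
      | zero => rfl
      | succ m ih => simp [bitList, topBit, grow, ih]
    simp [heightFn, this]
  | succ n ih =>
    have h1 := grow_row_conserve hω n m
    have h2 : heightFn (grow ω) (m + 1) (n + 1) =
        heightFn (grow ω) (m + 1) n + (grow ω m (n + 1)).1.toNat := by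
      unfold heightFn
      simp only [Nat.add_sub_cancel, Finset.card_filter]
      rw [Finset.sum_Icc_succ_top (by omega)]
      congr 1
      cases (grow ω m (n + 1)).1 <;> rfl
    omega

end Conservation

/-! ### Matching of the parameters and conclusion -/

theorem ParamsMatch.mul_eq_one {t Q : ℝ} {a b xi u : ℕ → ℝ} (h : SixVertexParams Q xi u)
    (hmatch : ParamsMatch t a b Q xi u) (x n : ℕ) :
    a (x + 1) * b (n + 1) * (√t * (xi (x + 1) * u (n + 1))) = 1 := by
  have ht : 0 < t := hmatch.t_eq ▸ h.Q_pos
  have h1 := (h.xi_pos (x + 1) (by omega)).ne'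
  have h2 := (h.u_pos (n + 1) (by omega)).ne'
  have hsq : √t * √t = t := Real.mul_self_sqrt ht.le
  rw [hmatch.a_eq _ (by omega), hmatch.b_eq _ (by omega)]
  field_simp
  rw [pow_two, hsq]

theorem ParamsMatch.mul_lt_one {t Q : ℝ} {a b xi u : ℕ → ℝ} (h : SixVertexParams Q xi u)
    (hmatch : ParamsMatch t a b Q xi u) (x n : ℕ) : a (x + 1) * b (n + 1) < 1 := by
  have ht : 0 < t := hmatch.t_eq ▸ h.Q_pos
  have h1 := h.lt_mul (x + 1) (n + 1) (by omega) (by omega)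
  rw [← hmatch.t_eq, div_lt_iff₀' (Real.sqrt_pos.2 ht)] at h1
  have h2 := hmatch.mul_eq_one h x n
  by_contra! hge
  nlinarith

theorem ruleMeasure_bitList_zero {Q : ℝ} {xi u : ℕ → ℝ} (h : SixVertexParams Q xi u) (v : List Bool) :
    ruleMeasure h {ω | bitList (topBit (grow ω) 0) v.length = v} = if true ∈ v then 0 else 1 := by
  have hrep : ∀ ω m, bitList (topBit (grow ω) 0) m = List.replicate m false := by
    intro ω m
    induction m with
    | zero => rfl
    | succ m ih => rw [bitList, ih, topBit, grow, List.replicate_succ]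
  simp only [hrep]
  by_cases hv : true ∈ v
  · rw [if_pos hv]
    convert measure_empty (μ := ruleMeasure h)
    ext ω
    simp only [Set.mem_ofPred_eq, Set.mem_empty_iff_false, iff_false]
    intro h
    rw [← h] at hv
    simp at hv
  · rw [if_neg hv]
    convert measure_univ (μ := ruleMeasure h)
    ext ω
    simp only [Set.mem_ofPred_eq, Set.mem_univ, iff_true]
    refine (List.eq_replicate_iff.2 ⟨rfl, fun c hc => ?_⟩).symm
    cases c
    · rfl
    · exact absurd hc hv

/-- The unnormalized law of the increments of the numbers of parts is the law of a row of vertical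
edges in the six vertex model. -/
theorem tsum_chainWeight_mul_hlQ {t Q : ℝ} {a b xi u : ℕ → ℝ} (h : SixVertexParams Q xi u)
    (hmatch : ParamsMatch t a b Q xi u) (ha : ∀ x, 0 ≤ a (x + 1)) (hb : ∀ n, 0 ≤ b (n + 1)) (M N : ℕ)
    (v : List Bool) (hv : v.length = M) :
    ∑' nu, chainWeight t a v nu * ENNReal.ofReal (hlQ t b N nu) =
      (∏ j ∈ Finset.Icc 1 N, ∏ i ∈ Finset.Icc 1 M,
        ENNReal.ofReal ((1 - t * a i * b j) / (1 - a i * b j))) *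
      ruleMeasure h {ω | bitList (topBit (grow ω) N) M = v} := by
  have ht : 0 < t := hmatch.t_eq ▸ h.Q_pos
  have ht1 : t < 1 := hmatch.t_eq ▸ h.Q_lt_one
  obtain rfl := hmatch.t_eq
  induction N generalizing v with
  | zero =>
    subst hv
    rw [ruleMeasure_bitList_zero, ← chainWeight_bot t a v,
      tsum_eq_single ⊥ fun nu hnu => by simp [hlQ, hnu]]
    simp [hlQ]
  | succ n ih =>
    rw [tsum_chainWeight_mul_hlQ_succ (s := fun x => xi (x + 1) * u (n + 1)) ht ht1 ha hb
      (fun x => hmatch.mul_lt_one h x n) (fun x => hmatch.mul_eq_one h x n)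
      (fun x i o => vertexWeight_nonneg h.Q_pos h.Q_lt_one
        (h.lt_mul (x + 1) (n + 1) (by omega) (by omega)) i o),
      ruleMeasure_bitList_succ, Finset.prod_Icc_succ_top (by omega), hv]
    rw [mul_comm (∏ j ∈ Finset.Icc 1 n, _) _, mul_assoc]
    congr 1
    rw [← ENNReal.tsum_mul_left]
    refine tsum_congr fun w => ?_
    -- The sum runs over lists of every length, but the induction hypothesis concerns length `M`
    -- only. For other lengths the row weight vanishes.
    by_cases hw : w.length = M
    · rw [ih w hw, mul_assoc]
    · have h0 : ∀ j, rowWeight t (fun x => xi (x + 1) * u (n + 1)) w v j = 0 := fun j => by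
        by_contra hne
        exact hw ((length_eq_of_rowWeight_ne_zero hne).trans hv)
      simp [h0]

/-- The increments of the numbers of parts in the ascending Hall–Littlewood process are distributed
as a row of vertical edges in the six vertex model. -/
theorem hlProcess_bitList_eq_sixVertexMeasure {t Q : ℝ} {a b xi u : ℕ → ℝ}
    (h : SixVertexParams Q xi u) (hmatch : ParamsMatch t a b Q xi u) (M N : ℕ) (v : List Bool) :
    hlProcess t a b M N {lam | bitList (lengthStep (hlLevel lam)) M = v} =
      sixVertexMeasure h {σ | bitList (topBit σ N) M = v} := by
  have ht : 0 < t := hmatch.t_eq ▸ h.Q_pos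
  have ht1 : t < 1 := hmatch.t_eq ▸ h.Q_lt_one
  have ha : ∀ x, 0 ≤ a (x + 1) := fun x => by
    rw [hmatch.a_eq _ (by omega)]
    exact div_nonneg (Real.sqrt_nonneg _) (h.xi_pos _ (by omega)).le
  have hb : ∀ n, 0 ≤ b (n + 1) := fun n => by
    rw [hmatch.b_eq _ (by omega)]
    exact one_div_nonneg.2 (mul_nonneg ht.le (h.u_pos _ (by omega)).le)
  by_cases hv : v.length = M
  · rw [hlProcess_bitList ht ht1 ha hb (fun x n => hmatch.mul_lt_one h x n) v hv,
      tsum_chainWeight_mul_hlQ h hmatch ha hb M N v hv, sixVertexMeasure,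
      Measure.map_apply measurable_grow (measurableSet_bitList (measurable_topBit N) M v),
      mul_comm, ENNReal.mul_div_cancel_right]
    · rfl
    · refine Finset.prod_ne_zero_iff.2 fun j hj => Finset.prod_ne_zero_iff.2 fun i hi => ?_
      obtain ⟨x, rfl⟩ : ∃ x, i = x + 1 := ⟨i - 1, by have := Finset.mem_Icc.1 hi; omega⟩
      obtain ⟨n, rfl⟩ : ∃ n, j = n + 1 := ⟨j - 1, by have := Finset.mem_Icc.1 hj; omega⟩
      have h1 := hmatch.mul_lt_one h x n
      have h2 := mul_nonneg (ha x) (hb n)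
      refine (ENNReal.ofReal_pos.2 (div_pos ?_ (by linarith))).ne'
      nlinarith
    · exact ENNReal.prod_ne_top fun j _ => ENNReal.prod_ne_top fun i _ => ENNReal.ofReal_ne_top
  · have e1 : {lam : Fin M → YoungDiagram | bitList (lengthStep (hlLevel lam)) M = v} = ∅ := by
      ext lam
      simp only [Set.mem_ofPred_eq, Set.mem_empty_iff_false, iff_false]
      rintro rfl
      exact hv (length_bitList _ _)
    have e2 : {σ : EdgeConfig | bitList (topBit σ N) M = v} = ∅ := by
      ext σ
      simp only [Set.mem_ofPred_eq, Set.mem_empty_iff_false, iff_false]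
      rintro rfl
      exact hv (length_bitList _ _)
    rw [e1, e2, measure_empty, measure_empty]

theorem ae_sixVertexMeasure_heightFn {Q : ℝ} {xi u : ℕ → ℝ} (h : SixVertexParams Q xi u)
    (M N : ℕ) {m : ℕ} (hm : m ≤ M) : ∀ᵐ σ ∂sixVertexMeasure h,
      (heightFn σ (m + 1) N : ℤ) = N - ((bitList (topBit σ N) M).drop (M - m)).count true := by
  have hmeas : MeasurableSet {σ : EdgeConfig |
      heightFn σ (m + 1) N + (bitList (topBit σ N) m).count true = N} := by
    have hh : Measurable fun σ : EdgeConfig => heightFn σ (m + 1) N := by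
      unfold heightFn
      simp only [Finset.card_filter]
      refine Finset.measurable_fun_sum _ fun y _ => ?_
      have : Measurable fun σ : EdgeConfig => (σ (m + 1 - 1) y).1 := by fun_prop
      exact Measurable.ite (this (measurableSet_singleton true)) measurable_const measurable_const
    have hc : Measurable fun σ : EdgeConfig => (bitList (topBit σ N) m).count true := by
      refine measurable_to_countable' fun c => ?_
      have : (fun σ : EdgeConfig => (bitList (topBit σ N) m).count true) ⁻¹' {c} =
          ⋃ v : {v : List Bool // v.count true = c}, {σ | bitList (topBit σ N) m = v} := by
        ext σ
        simp
      rw [this]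
      exact MeasurableSet.iUnion fun v => measurableSet_bitList (measurable_topBit N) m v
    exact (hh.add hc) (measurableSet_singleton N)
  have hae : ∀ᵐ σ ∂sixVertexMeasure h,
      heightFn σ (m + 1) N + (bitList (topBit σ N) m).count true = N := by
    rw [sixVertexMeasure, ae_map_iff measurable_grow.aemeasurable hmeas]
    filter_upwards [ae_ruleMeasure_conserve h] with ω hω
    exact heightFn_grow_add hω N m
  filter_upwards [hae] with σ hσ
  rw [drop_bitList _ hm]
  omega

theorem mainTheorem3 (t : ℝ) (a b : ℕ → ℝ) (Q : ℝ) (xi u : ℕ → ℝ)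
    (h6v : SixVertexParams Q xi u) (hmatch : ParamsMatch t a b Q xi u)
    (N k M : ℕ) (hN : 1 ≤ N) (hk : 1 ≤ k) (m : Fin k → ℕ)
    (hm : ∀ i, 1 ≤ m i ∧ m i ≤ M) :
    IdentDistrib
      (fun (lam : Fin M → YoungDiagram) (i : Fin k) =>
        (N : ℤ) - ((hlLevel lam (m i)).colLen 0 : ℤ))
      (fun (σ : EdgeConfig) (i : Fin k) => (heightFn σ (m i + 1) N : ℤ))
      (hlProcess t a b M N) (sixVertexMeasure h6v) := by
  -- With the discrete σ-algebra on a countable set, equality of laws reduces to singletons, and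
  -- every function of the bit list is measurable.
  let _ : MeasurableSpace (List Bool) := ⊤
  have : MeasurableSingletonClass (List Bool) := ⟨fun _ => trivial⟩
  have hf : Measurable fun lam : Fin M → YoungDiagram => bitList (lengthStep (hlLevel lam)) M :=
    measurable_to_countable' fun v => (Set.to_countable _).measurableSet
  have hg : Measurable fun σ : EdgeConfig => bitList (topBit σ N) M :=
    measurable_to_countable' fun v => measurableSet_bitList (measurable_topBit N) M v
  have hid : IdentDistrib (fun lam : Fin M → YoungDiagram => bitList (lengthStep (hlLevel lam)) M)
      (fun σ : EdgeConfig => bitList (topBit σ N) M) (hlProcess t a b M N)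
      (sixVertexMeasure h6v) := by
    refine ⟨hf.aemeasurable, hg.aemeasurable, Measure.ext_of_singleton fun v => ?_⟩
    rw [Measure.map_apply hf (measurableSet_singleton v),
      Measure.map_apply hg (measurableSet_singleton v)]
    exact hlProcess_bitList_eq_sixVertexMeasure h6v hmatch M N v
  have hF : Measurable fun (v : List Bool) (i : Fin k) =>
      (N : ℤ) - ((v.drop (M - m i)).count true : ℤ) := measurable_from_top
  have hcomp := hid.comp hF
  have hmeas : Measurable fun (lam : Fin M → YoungDiagram) (i : Fin k) =>
      (N : ℤ) - ((hlLevel lam (m i)).colLen 0 : ℤ) :=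
    measurable_to_countable' fun v => (Set.to_countable _).measurableSet
  have e1 : IdentDistrib _ _ (hlProcess t a b M N) (hlProcess t a b M N) :=
    IdentDistrib.of_ae_eq hmeas.aemeasurable (g := (fun (v : List Bool) (i : Fin k) =>
      (N : ℤ) - ((v.drop (M - m i)).count true : ℤ)) ∘
        fun lam : Fin M → YoungDiagram => bitList (lengthStep (hlLevel lam)) M) (by
      filter_upwards [ae_hlProcess_colLen t a b M N] with lam hlam
      funext i
      rw [hlam _ (hm i).2]
      rfl)
  refine (e1.trans hcomp).trans (IdentDistrib.of_ae_eq hcomp.aemeasurable_snd ?_)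
  have hall : ∀ᵐ σ ∂sixVertexMeasure h6v, ∀ i : Fin k, (heightFn σ (m i + 1) N : ℤ) =
      N - ((bitList (topBit σ N) M).drop (M - m i)).count true :=
    ae_all_iff.2 fun i => ae_sixVertexMeasure_heightFn h6v M N (hm i).2
  filter_upwards [hall] with σ hσ
  funext i
  exact (hσ i).symm
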